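/- Let $0<\alpha\le 1$ and $\lambda>0$. Let $N$ be a Poisson process of rate $\lambda$ and let $\mathfrak A^\alpha$ be an independent $\alpha$-stable subordinator with $\mathbb E e^{-\xi \mathfrak A^\alpha_t}=e^{-t\xi^\alpha}$, $\xi\ge 0$. Let $p_k(t;\alpha,1)=\Pr\{N(\mathfrak A^\alpha_t)=k\}$ for $k\in\mathbb Z$, $t\ge 0$ (so $p_{-1}=0$), and let $Bp_k=p_{k-1}$. For $\nu>0$ and $m=\lfloor\nu\rfloor+1$, let $$\frac{d^\nu}{d(-x)^\nu}f(x)=\frac{1}{\Gamma(m-\nu)}\Big(-\frac{d}{dx}\Big)^m\int_x^{\infty}\frac{f(s)\,ds}{(s-x)^{1+\nu-m}}$$ be the Riemann–Liouville derivative (for an integer $\nu=n$ this is $(-d/dx)^n f$, for $f$ integrable at infinity). Then, for all $k=0,1,2,\dots$ and $t>0$, $$\Big(\frac{d^{1/\alpha}}{d(-t)^{1/\alpha}}-\lambda(I-B)\Big)p_k(t;\alpha,1)=0 ,$$ with $p_0(0;\alpha,1)=1$, $p_k(0;\alpha,1)=0$ for $k\ge 1$. Moreover $p_k(\cdot;\alpha,1)$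 is smooth on $[0,\infty)$ and $$\frac{d^j}{dt^j}p_k(t;\alpha,1)\Big|_{t=0}=(-1)^{k+j}\,\frac{\lambda^{\alpha j}}{k!}\,\frac{\Gamma(\alpha j+1)}{\Gamma(\alpha j+1-k)},\qquad j=1,\dots,\lfloor 1/\alpha\rfloor-1 .$$ If $\alpha<1$, then for every $t>0$ the variable $\mathfrak A^\alpha_t$ has a density $h_\alpha(\cdot,t)$ on $(0,\infty)$ that is continuous there. It satisfies, for $x,t>0$, $$\Big(\frac{\partial^{1/\alpha}}{\partial(-t)^{1/\alpha}}-\frac{\partial}{\partial x}\Big)h_\alpha(x,t)=0 ,$$ with $h_\alpha(x,t)\,dx\to\delta_0$ weakly as $t\downarrow 0$ and $h_\alpha(x,t)\to 0$ as $x\downarrow 0$ for each $t>0$. Finally, for every $x>0$ the function $h_\alpha(x,\cdot)$ extends smoothly to $[0,\infty)$, and $$\frac{\partial^j}{\partial t^j}h_\alpha(x,t)\Big|_{t=0}=(-1)^j\frac{x^{-\alpha j-1}}{\Gamma(-\alpha j)},\qquad j=1,\dots,\lfloor 1/\alpha\rfloor-1 .$$ -/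

import Mathlib

open MeasureTheory ProbabilityTheory Set Filter Topology
open scoped NNReal ENNReal

noncomputable section

/-- A subordinator: a process issued from `0` with independent and stationary increments whose
paths are almost surely nondecreasing and right-continuous. -/
structure IsSubordinator {Ω : Type*} [MeasurableSpace Ω] (X : ℝ≥0 → Ω → ℝ)
    (μ : Measure Ω) : Prop where
  measurable : ∀ t, Measurable (X t)
  zero : ∀ᵐ ω ∂μ, X 0 ω = 0
  indep : HasIndepIncrements X μ
  stationary : ∀ s t : ℝ≥0, IdentDistrib (fun ω => X (s + t) ω - X s ω) (X t) μ μ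
  paths : ∀ᵐ ω ∂μ, Monotone (fun t => X t ω) ∧
    ∀ t, ContinuousWithinAt (fun s => X s ω) (Ici t) t

/-- The homogeneous Poisson process of intensity `rate`. -/
structure IsPoissonProcess {Ω : Type*} [MeasurableSpace Ω] (rate : ℝ≥0) (N : ℝ≥0 → Ω → ℕ)
    (μ : Measure Ω) : Prop where
  measurable : ∀ t, Measurable (N t)
  subordinator : IsSubordinator (fun t ω => (N t ω : ℝ)) μ
  law : ∀ t : ℝ≥0, μ.map (N t) = poissonMeasure (rate * t)

/-- The `α`-stable subordinator, normalized by `𝔼 exp (-ξ A_t) = exp (-t ξ ^ α)`. -/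
structure IsStableSubordinator {Ω : Type*} [MeasurableSpace Ω] (α : ℝ) (A : ℝ≥0 → Ω → ℝ≥0)
    (μ : Measure Ω) : Prop where
  measurable : ∀ t, Measurable (A t)
  subordinator : IsSubordinator (fun t ω => (A t ω : ℝ)) μ
  laplace : ∀ (t : ℝ≥0) (ξ : ℝ), 0 ≤ ξ →
    ∫ ω, Real.exp (-ξ * (A t ω : ℝ)) ∂μ = Real.exp (-(t : ℝ) * ξ ^ α)

/-- The distribution `p_k(t) = Pr {X_t = k}`, `k ∈ ℤ`, `t ≥ 0`, of a counting process `X`;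
in particular `p_k = 0` for `k < 0`. -/
def countingLaw {Ω : Type*} [MeasurableSpace Ω] (μ : Measure Ω) (X : ℝ≥0 → Ω → ℕ)
    (k : ℤ) (t : ℝ) : ℝ :=
  μ.real {ω | (X t.toNNReal ω : ℤ) = k}

/-- The backward shift `(B u)(k) = u (k - 1)` on functions of an integer variable. -/
def backwardShift (u : ℤ → ℝ) : ℤ → ℝ := fun k => u (k - 1)

/-- The fractional integral
`x ↦ Γ(m - ν)⁻¹ ∫_x^∞ f(s) (s - x)^(-(1 + ν - m)) ds`, with `m = ⌊ν⌋ + 1`. -/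
def rlIntegral (ν : ℝ) (f : ℝ → ℝ) (x : ℝ) : ℝ :=
  1 / Real.Gamma (((⌊ν⌋₊ + 1 : ℕ) : ℝ) - ν) *
    ∫ s in Ioi x, f s / (s - x) ^ (1 + ν - ((⌊ν⌋₊ + 1 : ℕ) : ℝ))

/-- `HasRLDeriv ν f x v`: the Riemann–Liouville (Weyl) derivative `d^ν f / d(-x)^ν`
of order `ν ≥ 0`, namely `(-d/dx)^m` applied to `rlIntegral ν f` with `m = ⌊ν⌋ + 1`,
exists at `x` and equals `v`. For `ν` not an integer, `m - 1 < ν < m`.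
For `ν = n` an integer, `m = n + 1` and the fractional integral is `∫_x^∞ f(s) ds`,
so that the derivative is the ordinary `(-d/dx)^n f`. -/
structure HasRLDeriv (ν : ℝ) (f : ℝ → ℝ) (x v : ℝ) : Prop where
  integrable : ∀ᶠ y in 𝓝 x,
    IntegrableOn (fun s => f s / (s - y) ^ (1 + ν - ((⌊ν⌋₊ + 1 : ℕ) : ℝ))) (Ioi y)
  contDiffAt : ContDiffAt ℝ (⌊ν⌋₊ + 1 : ℕ) (rlIntegral ν f) x
  eq : (-1) ^ (⌊ν⌋₊ + 1) * iteratedDeriv (⌊ν⌋₊ + 1) (rlIntegral ν f) x = v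

/-- `h x t`, `x, t > 0`, is the density at `x` of `A_t` for every `t > 0`, in its version that is
continuous in `x > 0` (which is unique). -/
structure IsContinuousDensity {Ω : Type*} [MeasurableSpace Ω] (μ : Measure Ω)
    (A : ℝ≥0 → Ω → ℝ≥0) (h : ℝ → ℝ → ℝ) : Prop where
  nonneg : ∀ x t, 0 < x → 0 < t → 0 ≤ h x t
  continuousOn : ∀ t, 0 < t → ContinuousOn (fun x => h x t) (Ioi 0)
  law : ∀ t : ℝ, 0 < t → μ.map (fun ω => (A t.toNNReal ω : ℝ)) =
    (volume.restrict (Ioi 0)).withDensity (fun x => ENNReal.ofReal (h x t))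

end

/-! Both p_k(t) and h_α(x, t) are real parts of superpositions ∫ W(y) exp(-t c(y)) dm(y) whose rates
lie in a sector Re c ≥ κ|c| with κ > 0. By Euler's integral the fractional integral of order β of
exp(-t c) is c^(-β) exp(-t c). Fubini and differentiation under the integral sign then show that the
Weyl derivative of order ν multiplies the weight W by c^ν (`hasRLDeriv_re_integral`). In both cases
c = z^α, and (z^α)^(1/α) = z on the principal branch, so the derivative of order 1/α inserts the
factor z. It remains to recognise multiplication by z.

For the law, conditioning on A_t gives p_k(t) = λ^k/k! · E[A_t^k exp(-λ A_t)], which is (-λ)^k/k!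
times the k-th derivative of exp(-t z^α) at z = λ. Cauchy's formula writes this over the circle |z -
λ| = λ/2 with weight (-λ/(z - λ))^k/(2π). Splitting z = λ + (z - λ) turns multiplication by z into
λ(I - B) (`integral_circleWeight_mul_center`). At t = 0 the j-th derivative is, up to sign, the same
Cauchy integral of z^(αj), whence the quotient of Gamma values.

For the density, the Bromwich integral is folded onto rays of arguments ±θ with π/2 < θ < π and αθ <
π/2, where exp(x s) and exp(-t s^α) both decay. Multiplication by s is then ∂/∂x, which is the
equation. That this integral is the density follows from its Laplace transform. Fubini leaves the
ray integral of exp(-t s^α)/(ξ - s). Subtracting a rational function that cancels the pole at ξ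
leaves a function real on the positive axis, whose ray integral can be rotated there and has no
imaginary part; the rational piece integrates to logarithms
(`IsDecayAngle.re_integral_spaceWeight_div`). Uniqueness of Laplace transforms gives the law and the
positivity together (`eq_withDensity_of_laplace_eq`). The derivatives at t = 0 are Euler integrals,
simplified by the reflection formula. -/

/-! ### Superpositions of exponentials with rates in a sector. -/

section ExponentialIntegral

variable {Y : Type*} [MeasurableSpace Y] {m : Measure Y}

theorem norm_cexp_neg_ofReal_mul (x : ℝ) (c : ℂ) :
    ‖Complex.exp (-x * c)‖ = Real.exp (-x * c.re) := by
  rw [Complex.norm_exp]; simp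

/-- A factor c costs only a small part of the exponential: for a < b < x the sector condition gives
(x - b) κ ‖c‖ ≤ exp((x - b) Re c). This is why integrability is assumed on an open half line. -/
theorem integrable_mul_neg_mul_exp {W c : Y → ℂ} {κ a : ℝ} (hκ : 0 < κ)
    (hc : Measurable c) (hW : AEStronglyMeasurable W m) (hcκ : ∀ᵐ y ∂m, κ * ‖c y‖ ≤ (c y).re)
    (hint : ∀ x, a < x → Integrable (fun y => ‖W y‖ * Real.exp (-x * (c y).re)) m)
    {x : ℝ} (hx : a < x) :
    Integrable (fun y => ‖W y * -c y‖ * Real.exp (-x * (c y).re)) m := by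
  obtain ⟨b, hab, hbx⟩ := exists_between hx
  have hε : 0 < x - b := sub_pos.2 hbx
  refine ((hint b hab).const_mul (1 / ((x - b) * κ))).mono' ?_ ?_
  · have : Measurable fun y => (c y).re := Complex.measurable_re.comp hc
    have h2 : AEStronglyMeasurable (fun y => Real.exp (-x * (c y).re)) m :=
      (by fun_prop : Measurable fun y => Real.exp (-x * (c y).re)).aestronglyMeasurable
    exact (hW.mul hc.neg.aestronglyMeasurable).norm.mul h2
  · filter_upwards [hcκ] with y hy
    rw [Real.norm_of_nonneg (by positivity), norm_mul, norm_neg]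
    have h1 : (x - b) * κ * ‖c y‖ ≤ Real.exp ((x - b) * (c y).re) := by
      have := Real.add_one_le_exp ((x - b) * (c y).re)
      nlinarith [mul_le_mul_of_nonneg_left hy hε.le]
    have h2 : Real.exp (-b * (c y).re)
        = Real.exp ((x - b) * (c y).re) * Real.exp (-x * (c y).re) := by
      rw [← Real.exp_add]; ring_nf
    rw [h2, div_mul_eq_mul_div, le_div_iff₀ (by positivity)]
    calc ‖W y‖ * ‖c y‖ * Real.exp (-x * (c y).re) * ((x - b) * κ)
        = ‖W y‖ * ((x - b) * κ * ‖c y‖) * Real.exp (-x * (c y).re) := by ring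
      _ ≤ ‖W y‖ * Real.exp ((x - b) * (c y).re) * Real.exp (-x * (c y).re) := by gcongr
      _ = _ := by ring

theorem aestronglyMeasurable_mul_cexp {W c : Y → ℂ} (hc : Measurable c)
    (hW : AEStronglyMeasurable W m) (x : ℝ) :
    AEStronglyMeasurable (fun y => W y * Complex.exp (-x * c y)) m :=
  hW.mul (by fun_prop : Measurable fun y => Complex.exp (-x * c y)).aestronglyMeasurable

theorem integrable_mul_cexp {W c : Y → ℂ} (hc : Measurable c) (hW : AEStronglyMeasurable W m)
    {x : ℝ} (hint : Integrable (fun y => ‖W y‖ * Real.exp (-x * (c y).re)) m) :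
    Integrable (fun y => W y * Complex.exp (-x * c y)) m := by
  refine hint.mono' (aestronglyMeasurable_mul_cexp hc hW x) (Eventually.of_forall fun y => ?_)
  rw [norm_mul, norm_cexp_neg_ofReal_mul]

/-- Since Re c ≥ 0, the differentiated integrand at any z > b is dominated by its size at b, with a
< b < x. -/
theorem hasDerivAt_integral_mul_cexp {W c : Y → ℂ} {κ a : ℝ} (hκ : 0 < κ)
    (hc : Measurable c) (hW : AEStronglyMeasurable W m) (hcκ : ∀ᵐ y ∂m, κ * ‖c y‖ ≤ (c y).re)
    (hint : ∀ x, a < x → Integrable (fun y => ‖W y‖ * Real.exp (-x * (c y).re)) m)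
    {x : ℝ} (hx : a < x) :
    HasDerivAt (fun x : ℝ => ∫ y, W y * Complex.exp (-x * c y) ∂m)
      (∫ y, W y * -c y * Complex.exp (-x * c y) ∂m) x := by
  obtain ⟨b, hab, hbx⟩ := exists_between hx
  refine (hasDerivAt_integral_of_dominated_loc_of_deriv_le (s := Ioi b)
    (bound := fun y => ‖W y * -c y‖ * Real.exp (-b * (c y).re))
    (F' := fun x y => W y * -c y * Complex.exp (-x * c y))
    (Ioi_mem_nhds hbx) ?_ ?_ ?_ ?_ ?_ ?_).2
  · exact Eventually.of_forall fun x => aestronglyMeasurable_mul_cexp hc hW x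
  · exact integrable_mul_cexp hc hW (hint x hx)
  · exact aestronglyMeasurable_mul_cexp hc (hW.mul hc.neg.aestronglyMeasurable) x
  · filter_upwards [hcκ] with y hy z hz
    rw [norm_mul, norm_cexp_neg_ofReal_mul]
    have : 0 ≤ (c y).re := le_trans (by positivity) hy
    have hz' : b ≤ z := le_of_lt hz
    gcongr
  · exact integrable_mul_neg_mul_exp hκ hc hW hcκ hint hab
  · refine Eventually.of_forall fun y z _ => ?_
    have h1 : HasDerivAt (fun z : ℝ => -(z : ℂ) * c y) (-c y) z := by
      simpa using (Complex.ofRealCLM.hasDerivAt (x := z)).neg.mul_const (c y)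
    exact (h1.cexp.const_mul (W y)).congr_deriv (by ring)

theorem eqOn_iteratedDeriv_of_hasDerivAt_succ {f : ℕ → ℝ → ℝ} {s : Set ℝ} (hs : IsOpen s)
    (h : ∀ n, ∀ x ∈ s, HasDerivAt (f n) (f (n + 1) x) x) (n : ℕ) :
    EqOn (iteratedDeriv n (f 0)) (f n) s := by
  induction n with
  | zero => intro x _; simp
  | succ n ih =>
    intro x hx
    rw [iteratedDeriv_succ, (ih.eventuallyEq_of_mem (hs.mem_nhds hx)).deriv_eq, (h n x hx).deriv]

theorem contDiffOn_of_hasDerivAt_succ {f : ℕ → ℝ → ℝ} {s : Set ℝ} (hs : IsOpen s)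
    (h : ∀ n, ∀ x ∈ s, HasDerivAt (f n) (f (n + 1) x) x) :
    ContDiffOn ℝ (⊤ : ℕ∞) (f 0) s := by
  refine contDiffOn_of_differentiableOn_deriv fun n _ => ?_
  have : EqOn (iteratedDerivWithin n (f 0) s) (f n) s :=
    (iteratedDerivWithin_of_isOpen hs).trans (eqOn_iteratedDeriv_of_hasDerivAt_succ hs h n)
  exact DifferentiableOn.congr
    (fun x hx => (h n x hx).differentiableAt.differentiableWithinAt) this

/-- Each differentiation replaces W by W · (-c), and the new weight satisfies the same hypotheses,
so the one-step result iterates. -/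
theorem hasDerivAt_re_integral_succ {W c : Y → ℂ} {κ a : ℝ} (hκ : 0 < κ)
    (hc : Measurable c) (hW : AEStronglyMeasurable W m) (hcκ : ∀ᵐ y ∂m, κ * ‖c y‖ ≤ (c y).re)
    (hint : ∀ x, a < x → Integrable (fun y => ‖W y‖ * Real.exp (-x * (c y).re)) m)
    (n : ℕ) {x : ℝ} (hx : a < x) :
    HasDerivAt (fun x : ℝ => (∫ y, W y * (-c y) ^ n * Complex.exp (-x * c y) ∂m).re)
      (∫ y, W y * (-c y) ^ (n + 1) * Complex.exp (-x * c y) ∂m).re x := by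
  have key : AEStronglyMeasurable (fun y => W y * (-c y) ^ n) m ∧
      ∀ x, a < x → Integrable (fun y => ‖W y * (-c y) ^ n‖ * Real.exp (-x * (c y).re)) m := by
    refine ⟨hW.mul (hc.neg.pow_const n).aestronglyMeasurable, ?_⟩
    induction n with
    | zero => simpa using hint
    | succ n ih =>
      intro x hx
      have := integrable_mul_neg_mul_exp (W := fun y => W y * (-c y) ^ n) hκ hc
        (hW.mul (hc.neg.pow_const n).aestronglyMeasurable) hcκ ih hx
      simpa only [pow_succ, mul_assoc] using this
  have := hasDerivAt_integral_mul_cexp hκ hc key.1 hcκ key.2 hx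
  have h2 := (Complex.reCLM.hasFDerivAt.comp_hasDerivAt x this)
  simpa only [pow_succ, mul_assoc] using! h2

theorem contDiffOn_re_integral {W c : Y → ℂ} {κ a : ℝ} (hκ : 0 < κ)
    (hc : Measurable c) (hW : AEStronglyMeasurable W m) (hcκ : ∀ᵐ y ∂m, κ * ‖c y‖ ≤ (c y).re)
    (hint : ∀ x, a < x → Integrable (fun y => ‖W y‖ * Real.exp (-x * (c y).re)) m) :
    ContDiffOn ℝ (⊤ : ℕ∞) (fun x : ℝ => (∫ y, W y * Complex.exp (-x * c y) ∂m).re) (Ioi a) := by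
  have := contDiffOn_of_hasDerivAt_succ isOpen_Ioi
    fun n x hx => hasDerivAt_re_integral_succ hκ hc hW hcκ hint n hx
  simpa using this

theorem iteratedDeriv_re_integral {W c : Y → ℂ} {κ a : ℝ} (hκ : 0 < κ)
    (hc : Measurable c) (hW : AEStronglyMeasurable W m) (hcκ : ∀ᵐ y ∂m, κ * ‖c y‖ ≤ (c y).re)
    (hint : ∀ x, a < x → Integrable (fun y => ‖W y‖ * Real.exp (-x * (c y).re)) m)
    (n : ℕ) {x : ℝ} (hx : a < x) :
    iteratedDeriv n (fun x : ℝ => (∫ y, W y * Complex.exp (-x * c y) ∂m).re) x =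
      (∫ y, W y * (-c y) ^ n * Complex.exp (-x * c y) ∂m).re := by
  have := eqOn_iteratedDeriv_of_hasDerivAt_succ isOpen_Ioi
    (fun n x hx => hasDerivAt_re_integral_succ hκ hc hW hcκ hint n hx) n hx
  simpa using this

end ExponentialIntegral

/-! ### Analytic continuation and uniqueness of Laplace transforms. -/

section LaplaceTransform

variable {Ω : Type*} [MeasurableSpace Ω] {μ : Measure Ω}

theorem subset_interior_integrableExpSet {X : Ω → ℝ}
    (hint : ∀ ξ : ℝ, 0 < ξ → Integrable (fun ω => Real.exp (-ξ * X ω)) μ) :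
    Iio 0 ⊆ interior (integrableExpSet X μ) :=
  interior_maximal (fun ξ hξ => by
    simpa [integrableExpSet] using hint (-ξ) (by simpa using hξ)) isOpen_Iio

/-- A holomorphic function on the right half plane which agrees with a Laplace transform on the
positive axis agrees with it on the half plane. -/
theorem integral_cexp_neg_mul_eq {X : Ω → ℝ}
    (hint : ∀ ξ : ℝ, 0 < ξ → Integrable (fun ω => Real.exp (-ξ * X ω)) μ) {G : ℂ → ℂ}
    (hG : DifferentiableOn ℂ G {z | 0 < z.re})
    (hreal : ∀ ξ : ℝ, 0 < ξ → ((∫ ω, Real.exp (-ξ * X ω) ∂μ : ℝ) : ℂ) = G ξ)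
    {z : ℂ} (hz : 0 < z.re) : ∫ ω, Complex.exp (-z * X ω) ∂μ = G z := by
  have hU : IsOpen {z : ℂ | 0 < z.re} := isOpen_lt continuous_const Complex.continuous_re
  have h1 : AnalyticOnNhd ℂ (fun z => complexMGF X μ (-z)) {z | 0 < z.re} := by
    refine DifferentiableOn.analyticOnNhd ?_ hU
    refine (differentiableOn_complexMGF (X := X) (μ := μ)).comp differentiable_neg.differentiableOn
      fun z (hz : 0 < z.re) => subset_interior_integrableExpSet hint (by simpa using hz)
  have h2 := h1.eqOn_of_preconnected_of_frequently_eq (hG.analyticOnNhd hU)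
    (convex_halfSpace_re_gt 0).isPreconnected (z₀ := 1) (by simp) ?_
  · exact h2 hz
  -- The identity theorem needs agreement at points accumulating at 1; the reals x > 1 provide them.
  · have h3 : Tendsto (fun x : ℝ => (x : ℂ)) (𝓝[>] 1) (𝓝[≠] 1) := by
      refine tendsto_nhdsWithin_iff.2 ⟨?_, ?_⟩
      · exact (Complex.continuous_ofReal.tendsto' 1 1 (by simp)).mono_left nhdsWithin_le_nhds
      · filter_upwards [self_mem_nhdsWithin] with x hx
        simpa using (ne_of_gt hx)
    refine h3.frequently (Eventually.frequently ?_)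
    filter_upwards [self_mem_nhdsWithin] with x hx
    have : (0 : ℝ) < x := lt_trans one_pos hx
    rw [← hreal x this, ← Complex.ofReal_neg, complexMGF_ofReal]
    simp [mgf]

/-- Two measures on the line with the same finite Laplace transform are equal. -/
theorem MeasureTheory.Measure.ext_of_laplace {ν₁ ν₂ : Measure ℝ}
    (h₁ : ∀ ξ : ℝ, 0 < ξ → Integrable (fun x => Real.exp (-ξ * x)) ν₁)
    (h₂ : ∀ ξ : ℝ, 0 < ξ → Integrable (fun x => Real.exp (-ξ * x)) ν₂)
    (h : ∀ ξ : ℝ, 0 < ξ → ∫ x, Real.exp (-ξ * x) ∂ν₁ = ∫ x, Real.exp (-ξ * x) ∂ν₂) :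
    ν₁ = ν₂ := by
  -- Tilting by exp(-x) makes both measures finite. The characteristic function of the tilted
  -- measure is the Laplace transform on the line Re z = 1, which the real values determine by
  -- continuation.
  have hm : Measurable fun x : ℝ => ENNReal.ofReal (Real.exp (-1 * x)) := by fun_prop
  have hfin : ∀ ν : Measure ℝ, Integrable (fun x => Real.exp (-1 * x)) ν →
      IsFiniteMeasure (ν.withDensity fun x => ENNReal.ofReal (Real.exp (-1 * x))) :=
    fun ν hν => isFiniteMeasure_withDensity_ofReal hν.2
  have := hfin ν₁ (h₁ 1 one_pos)
  have := hfin ν₂ (h₂ 1 one_pos)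
  have hchar : ∀ (ν : Measure ℝ) (u : ℝ),
      charFun (ν.withDensity fun x => ENNReal.ofReal (Real.exp (-1 * x))) u =
        ∫ x, Complex.exp (-(1 - u * Complex.I) * (id x : ℝ)) ∂ν := by
    intro ν u
    rw [charFun_apply_real, integral_withDensity_eq_integral_toReal_smul hm (by simp)]
    refine integral_congr_ae (Eventually.of_forall fun x => ?_)
    simp only [Complex.real_smul, ENNReal.toReal_ofReal (Real.exp_nonneg _), Complex.ofReal_exp,
      ← Complex.exp_add, id]
    congr 1
    push_cast
    ring
  have heq : ν₁.withDensity (fun x => ENNReal.ofReal (Real.exp (-1 * x))) =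
      ν₂.withDensity fun x => ENNReal.ofReal (Real.exp (-1 * x)) := by
    refine Measure.ext_of_charFun (funext fun u => ?_)
    rw [hchar, hchar]
    refine integral_cexp_neg_mul_eq (X := id) h₁
      (G := fun z => ∫ x, Complex.exp (-z * (id x : ℝ)) ∂ν₂) ?_ ?_ (by simp)
    · refine (differentiableOn_complexMGF (X := id) (μ := ν₂)).comp
        differentiable_neg.differentiableOn
        fun z (hz : 0 < z.re) => subset_interior_integrableExpSet h₂ (by simpa using hz)
    · intro ξ hξ
      simp only [id]
      rw [h ξ hξ, ← integral_complex_ofReal]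
      push_cast
      rfl
  rw [← withDensity_inv_same (μ := ν₁) hm (by simp [Real.exp_pos]) (by simp),
    ← withDensity_inv_same (μ := ν₂) hm (by simp [Real.exp_pos]) (by simp), heq]

end LaplaceTransform

/-! ### Euler's Gamma integral with a complex rate. -/

section GammaIntegral

/-- A function that is not integrable has integral 0 by convention, so the nonzero value of the
integral certifies integrability. -/
theorem integrableOn_rpow_mul_exp_neg_mul {β b : ℝ} (hβ : 0 < β) (hb : 0 < b) :
    IntegrableOn (fun u : ℝ => u ^ (β - 1) * Real.exp (-(b * u))) (Ioi 0) := by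
  refine Integrable.of_integral_ne_zero ?_
  rw [Real.integral_rpow_mul_exp_neg_mul_Ioi hβ hb]
  have := Real.Gamma_pos_of_pos hβ
  positivity

theorem integrableOn_rpow_mul_exp_neg_mul_rpow_of_pos {p q b : ℝ} (hp : 0 < p) (hq : -1 < q)
    (hb : 0 < b) : IntegrableOn (fun x : ℝ => x ^ q * Real.exp (-b * x ^ p)) (Ioi 0) := by
  refine Integrable.of_integral_ne_zero ?_
  rw [integral_rpow_mul_exp_neg_mul_rpow hp hq hb]
  have := Real.Gamma_pos_of_pos (div_pos (by linarith : 0 < q + 1) hp)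
  positivity

/-- Euler's integral with a complex rate. -/
theorem integral_rpow_mul_cexp_neg_mul_Ioi {β : ℝ} (hβ : 0 < β) {c : ℂ} (hc : 0 < c.re) :
    ∫ u in Ioi (0 : ℝ), ((u ^ (β - 1) : ℝ) : ℂ) * Complex.exp (-c * u) =
      Real.Gamma β * c ^ (-β : ℂ) := by
  have hm : Measurable fun u : ℝ => ENNReal.ofReal (u ^ (β - 1)) := by fun_prop
  -- With u^(β-1) du as a measure, the integral is a Laplace transform. Its real values Γ(β) ξ^(-β)
  -- extend holomorphically to the half plane.
  set ν : Measure ℝ := (volume.restrict (Ioi 0)).withDensity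
    fun u : ℝ => ENNReal.ofReal (u ^ (β - 1)) with hν
  have hto : ∀ u ∈ Ioi (0 : ℝ), (ENNReal.ofReal (u ^ (β - 1))).toReal = u ^ (β - 1) :=
    fun u hu => ENNReal.toReal_ofReal (Real.rpow_nonneg (le_of_lt hu) _)
  have hint : ∀ ξ : ℝ, 0 < ξ → Integrable (fun u => Real.exp (-ξ * id u)) ν := by
    intro ξ hξ
    rw [hν, integrable_withDensity_iff hm (by simp)]
    refine (integrableOn_rpow_mul_exp_neg_mul hβ hξ).congr_fun (fun u hu => ?_) measurableSet_Ioi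
    simp only [hto u hu, id]
    rw [neg_mul, mul_comm]
  have hval : ∀ ξ : ℝ, 0 < ξ → ((∫ u, Real.exp (-ξ * id u) ∂ν : ℝ) : ℂ) =
      Real.Gamma β * (ξ : ℂ) ^ (-β : ℂ) := by
    intro ξ hξ
    have h1 : ∫ u, Real.exp (-ξ * id u) ∂ν = (1 / ξ) ^ β * Real.Gamma β := by
      rw [← Real.integral_rpow_mul_exp_neg_mul_Ioi hβ hξ, hν,
        integral_withDensity_eq_integral_toReal_smul hm (by simp)]
      refine setIntegral_congr_fun measurableSet_Ioi fun u hu => ?_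
      simp only [hto u hu, id, smul_eq_mul, neg_mul]
    rw [h1, one_div, Real.inv_rpow hξ.le, ← Real.rpow_neg hξ.le]
    push_cast [Complex.ofReal_cpow hξ.le]
    ring
  have := integral_cexp_neg_mul_eq hint
    (G := fun z => Real.Gamma β * z ^ (-β : ℂ)) ?_ hval hc
  · rw [← this, hν, integral_withDensity_eq_integral_toReal_smul hm (by simp)]
    refine setIntegral_congr_fun measurableSet_Ioi fun u hu => ?_
    simp only [hto u hu, id, Complex.real_smul]
  · intro z hz
    exact ((differentiableAt_id.cpow_const (Or.inl hz)).const_mul _).differentiableWithinAt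

end GammaIntegral

/-! ### The Weyl derivative of a superposition of exponentials. -/

section WeylDerivative

variable {Y : Type*} [MeasurableSpace Y] {m : Measure Y}

theorem setIntegral_Ioi_eq_comp_add {E : Type*} [NormedAddCommGroup E] [NormedSpace ℝ E]
    (F : ℝ → E) (y : ℝ) : ∫ s in Ioi y, F s = ∫ u in Ioi (0 : ℝ), F (u + y) := by
  have := (measurePreserving_add_right volume y).setIntegral_preimage_emb
    (measurableEmbedding_addRight y) F (Ioi y)
  simpa using this.symm

theorem integrableOn_Ioi_iff_comp_add {E : Type*} [NormedAddCommGroup E]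
    (F : ℝ → E) (y : ℝ) :
    IntegrableOn F (Ioi y) ↔ IntegrableOn (fun u => F (u + y)) (Ioi (0 : ℝ)) := by
  have := (measurePreserving_add_right volume y).integrableOn_comp_preimage
    (measurableEmbedding_addRight y) (f := F) (s := Ioi y)
  simpa [Function.comp_def] using this.symm

variable {W c : Y → ℂ} {κ β : ℝ}

/-- Integrating the norm in u produces Γ(β) (Re c)^(-β), and the sector condition bounds (Re c)^(-β)
by κ^(-β) ‖c‖^(-β). This licenses Fubini. -/
theorem integrable_prod_rpow_mul_cexp [SFinite m] (hκ : 0 < κ) (hβ : 0 < β) (hc : Measurable c)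
    (hW : AEStronglyMeasurable W m) (hcκ : ∀ᵐ y ∂m, κ * ‖c y‖ ≤ (c y).re)
    (hc0 : ∀ᵐ y ∂m, c y ≠ 0) {x : ℝ}
    (hint : Integrable (fun y => ‖W y‖ * ‖c y‖ ^ (-β) * Real.exp (-x * (c y).re)) m) :
    Integrable (Function.uncurry fun (u : ℝ) y =>
      ((u ^ (β - 1) : ℝ) : ℂ) * (W y * Complex.exp (-(u + x : ℝ) * c y)))
      ((volume.restrict (Ioi 0)).prod m) := by
  have hmeas : AEStronglyMeasurable (Function.uncurry fun (u : ℝ) y =>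
      ((u ^ (β - 1) : ℝ) : ℂ) * (W y * Complex.exp (-(u + x : ℝ) * c y)))
      ((volume.restrict (Ioi 0)).prod m) := by
    have h1 : Measurable fun p : ℝ × Y => ((p.1 ^ (β - 1) : ℝ) : ℂ) := by fun_prop
    have h2 : Measurable fun p : ℝ × Y => Complex.exp (-(p.1 + x : ℝ) * c p.2) := by fun_prop
    exact h1.aestronglyMeasurable.mul (hW.comp_snd.mul h2.aestronglyMeasurable)
  have hnorm : ∀ᵐ y ∂m, EqOn (fun u : ℝ =>
      ‖((u ^ (β - 1) : ℝ) : ℂ) * (W y * Complex.exp (-(u + x : ℝ) * c y))‖)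
      (fun u => (‖W y‖ * Real.exp (-x * (c y).re)) *
        (u ^ (β - 1) * Real.exp (-((c y).re * u)))) (Ioi 0) := by
    refine Eventually.of_forall fun y u hu => ?_
    simp only [norm_mul, norm_cexp_neg_ofReal_mul, Complex.norm_real,
      Real.norm_of_nonneg (Real.rpow_nonneg (le_of_lt hu) (β - 1))]
    rw [show -(u + x) * (c y).re = -x * (c y).re + -((c y).re * u) by ring, Real.exp_add]
    ring
  have hpos : ∀ᵐ y ∂m, 0 < (c y).re := by
    filter_upwards [hcκ, hc0] with y h1 h2
    exact lt_of_lt_of_le (mul_pos hκ (norm_pos_iff.2 h2)) h1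
  rw [integrable_prod_iff' hmeas]
  constructor
  · filter_upwards [hnorm, hpos, hmeas.prodMk_right] with y h1 h2 h3
    rw [← integrable_norm_iff h3]
    exact IntegrableOn.congr_fun ((integrableOn_rpow_mul_exp_neg_mul hβ h2).const_mul _) h1.symm
      measurableSet_Ioi
  · refine (hint.const_mul (κ ^ (-β) * Real.Gamma β)).mono' 
      hmeas.norm.prod_swap.integral_prod_right' ?_
    filter_upwards [hnorm, hpos, hcκ, hc0] with y h1 h2 h3 h4
    rw [Real.norm_of_nonneg (integral_nonneg fun _ => norm_nonneg _)]
    simp only [Function.uncurry_apply_pair]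
    rw [setIntegral_congr_fun measurableSet_Ioi h1, integral_const_mul,
      Real.integral_rpow_mul_exp_neg_mul_Ioi hβ h2, one_div, Real.inv_rpow h2.le,
      ← Real.rpow_neg h2.le]
    have h5 : (c y).re ^ (-β) ≤ κ ^ (-β) * ‖c y‖ ^ (-β) := by
      rw [← Real.mul_rpow hκ.le (norm_nonneg _)]
      exact Real.rpow_le_rpow_of_nonpos (mul_pos hκ (norm_pos_iff.2 h4)) h3 (by linarith)
    have := Real.Gamma_pos_of_pos hβ
    calc ‖W y‖ * Real.exp (-x * (c y).re) * ((c y).re ^ (-β) * Real.Gamma β)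
        ≤ ‖W y‖ * Real.exp (-x * (c y).re) * (κ ^ (-β) * ‖c y‖ ^ (-β) * Real.Gamma β) := by
          gcongr
      _ = _ := by ring

theorem integral_rpow_mul_integral_cexp [SFinite m] (hκ : 0 < κ) (hβ : 0 < β)
    (hc : Measurable c) (hW : AEStronglyMeasurable W m)
    (hcκ : ∀ᵐ y ∂m, κ * ‖c y‖ ≤ (c y).re) (hc0 : ∀ᵐ y ∂m, c y ≠ 0) {x : ℝ}
    (hint : Integrable (fun y => ‖W y‖ * ‖c y‖ ^ (-β) * Real.exp (-x * (c y).re)) m) :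
    ∫ u in Ioi (0 : ℝ), u ^ (β - 1) * (∫ y, W y * Complex.exp (-(u + x : ℝ) * c y) ∂m).re =
      Real.Gamma β * (∫ y, W y * c y ^ (-β : ℂ) * Complex.exp (-x * c y) ∂m).re := by
  have hprod := integrable_prod_rpow_mul_cexp hκ hβ hc hW hcκ hc0 hint
  have hswap := integral_integral_swap hprod
  have hright : ∫ y, (∫ u in Ioi (0 : ℝ),
      ((u ^ (β - 1) : ℝ) : ℂ) * (W y * Complex.exp (-(u + x : ℝ) * c y))) ∂m =
      Real.Gamma β * ∫ y, W y * c y ^ (-β : ℂ) * Complex.exp (-x * c y) ∂m := by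
    rw [← integral_const_mul]
    refine integral_congr_ae ?_
    filter_upwards [hcκ, hc0] with y h1 h2
    have hpos : 0 < (c y).re := lt_of_lt_of_le (mul_pos hκ (norm_pos_iff.2 h2)) h1
    calc ∫ u in Ioi (0 : ℝ), ((u ^ (β - 1) : ℝ) : ℂ) * (W y * Complex.exp (-(u + x : ℝ) * c y))
        = ∫ u in Ioi (0 : ℝ), W y * Complex.exp (-x * c y) *
            (((u ^ (β - 1) : ℝ) : ℂ) * Complex.exp (-c y * u)) := by
          refine setIntegral_congr_fun measurableSet_Ioi fun u _ => ?_
          have : Complex.exp (-(u + x : ℝ) * c y) =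
              Complex.exp (-x * c y) * Complex.exp (-c y * u) := by
            rw [← Complex.exp_add]
            congr 1
            push_cast
            ring
          simp only [this]
          ring
      _ = _ := by
          rw [integral_const_mul, integral_rpow_mul_cexp_neg_mul_Ioi hβ hpos]
          ring
  rw [hright] at hswap
  have hleft : Integrable (fun u : ℝ => ∫ y,
      ((u ^ (β - 1) : ℝ) : ℂ) * (W y * Complex.exp (-(u + x : ℝ) * c y)) ∂m)
      (volume.restrict (Ioi 0)) := hprod.integral_prod_left
  have h3 := congrArg Complex.re hswap
  rw [Complex.re_ofReal_mul] at h3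
  rw [← h3]
  have h4 := integral_re hleft
  simp only [RCLike.re_to_complex] at h4
  rw [← h4]
  refine integral_congr_ae (Eventually.of_forall fun u => ?_)
  simp only
  rw [integral_const_mul, Complex.re_ofReal_mul]

theorem integrableOn_rpow_mul_integral_cexp [SFinite m] (hκ : 0 < κ) (hβ : 0 < β)
    (hc : Measurable c) (hW : AEStronglyMeasurable W m)
    (hcκ : ∀ᵐ y ∂m, κ * ‖c y‖ ≤ (c y).re) (hc0 : ∀ᵐ y ∂m, c y ≠ 0) {x : ℝ}
    (hint : Integrable (fun y => ‖W y‖ * ‖c y‖ ^ (-β) * Real.exp (-x * (c y).re)) m) :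
    IntegrableOn (fun u : ℝ =>
      u ^ (β - 1) * (∫ y, W y * Complex.exp (-(u + x : ℝ) * c y) ∂m).re) (Ioi 0) := by
  have hprod := integrable_prod_rpow_mul_cexp hκ hβ hc hW hcκ hc0 hint
  have hleft : Integrable (fun u : ℝ => ∫ y,
      ((u ^ (β - 1) : ℝ) : ℂ) * (W y * Complex.exp (-(u + x : ℝ) * c y)) ∂m)
      (volume.restrict (Ioi 0)) := hprod.integral_prod_left
  refine hleft.re.congr (Eventually.of_forall fun u => ?_)
  simp only [RCLike.re_to_complex]
  rw [integral_const_mul, Complex.re_ofReal_mul]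

/-- The Weyl derivative of a superposition of exponentials is computed under the integral sign. -/
theorem hasRLDeriv_re_integral [SFinite m] {ν : ℝ} (hκ : 0 < κ)
    (hc : Measurable c) (hW : AEStronglyMeasurable W m)
    (hcκ : ∀ᵐ y ∂m, κ * ‖c y‖ ≤ (c y).re) (hc0 : ∀ᵐ y ∂m, c y ≠ 0)
    (hint : ∀ x : ℝ, 0 < x → Integrable (fun y =>
      ‖W y‖ * ‖c y‖ ^ (-(((⌊ν⌋₊ + 1 : ℕ) : ℝ) - ν)) * Real.exp (-x * (c y).re)) m)
    {f : ℝ → ℝ} (hf : ∀ s : ℝ, 0 < s → f s = (∫ y, W y * Complex.exp (-s * c y) ∂m).re)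
    {t : ℝ} (ht : 0 < t) :
    HasRLDeriv ν f t (∫ y, W y * c y ^ (ν : ℂ) * Complex.exp (-t * c y) ∂m).re := by
  set β : ℝ := ((⌊ν⌋₊ + 1 : ℕ) : ℝ) - ν with hβdef
  have hβ : 0 < β := by
    have := Nat.lt_floor_add_one ν
    simp only [hβdef]; push_cast; linarith
  -- After the shift s = u + x, the kernel of the fractional integral is u^(β-1) with β = m - ν and
  -- m = ⌊ν⌋ + 1.
  have hcongr : ∀ x : ℝ, 0 < x → EqOn
      (fun u : ℝ => f (u + x) / (u + x - x) ^ (1 + ν - ((⌊ν⌋₊ + 1 : ℕ) : ℝ)))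
      (fun u : ℝ => u ^ (β - 1) * (∫ y, W y * Complex.exp (-(u + x : ℝ) * c y) ∂m).re)
      (Ioi 0) := by
    intro x hx u hu
    have hu : 0 < u := hu
    simp only
    rw [hf (u + x) (by linarith), add_sub_cancel_right,
      show 1 + ν - ((⌊ν⌋₊ + 1 : ℕ) : ℝ) = -(β - 1) by rw [hβdef]; ring, Real.rpow_neg hu.le,
      div_inv_eq_mul, mul_comm]
  have hrl : ∀ x : ℝ, 0 < x → rlIntegral ν f x =
      (∫ y, W y * c y ^ (-β : ℂ) * Complex.exp (-x * c y) ∂m).re := by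
    intro x hx
    rw [rlIntegral, setIntegral_Ioi_eq_comp_add, setIntegral_congr_fun measurableSet_Ioi
      (hcongr x hx), integral_rpow_mul_integral_cexp hκ hβ hc hW hcκ hc0 (hint x hx), ← hβdef,
      ← mul_assoc, one_div_mul_cancel (Real.Gamma_pos_of_pos hβ).ne', one_mul]
  have hev : rlIntegral ν f =ᶠ[𝓝 t]
      fun x : ℝ => (∫ y, W y * c y ^ (-β : ℂ) * Complex.exp (-x * c y) ∂m).re := by
    filter_upwards [Ioi_mem_nhds ht] with x hx using hrl x hx
  have hW' : AEStronglyMeasurable (fun y => W y * c y ^ (-β : ℂ)) m :=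
    hW.mul (hc.pow_const _).aestronglyMeasurable
  have hint' : ∀ x : ℝ, 0 < x → Integrable (fun y =>
      ‖W y * c y ^ (-β : ℂ)‖ * Real.exp (-x * (c y).re)) m := by
    intro x hx
    refine (hint x hx).congr (Eventually.of_forall fun y => ?_)
    simp only
    rw [norm_mul, ← Complex.ofReal_neg, Complex.norm_cpow_real]
  refine ⟨?_, ?_, ?_⟩
  · filter_upwards [Ioi_mem_nhds ht] with x hx
    rw [integrableOn_Ioi_iff_comp_add]
    exact (integrableOn_rpow_mul_integral_cexp hκ hβ hc hW hcκ hc0 (hint x hx)).congr_fun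
      (hcongr x hx).symm measurableSet_Ioi
  · have := (contDiffOn_re_integral hκ hc hW' hcκ hint').contDiffAt (Ioi_mem_nhds ht)
    exact (this.congr_of_eventuallyEq hev).of_le (by exact_mod_cast le_top)
  · rw [hev.iteratedDeriv_eq, iteratedDeriv_re_integral hκ hc hW' hcκ hint' _ ht]
    rw [← Complex.re_ofReal_mul, ← integral_const_mul]
    congr 1
    refine integral_congr_ae ?_
    filter_upwards [hc0] with y hy
    -- The fractional integral contributed c^(-β) and the m derivatives (-c)^m; as m - β = ν this is
    -- c^ν up to (-1)^m, which the sign in the Weyl derivative removes.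
    have h2 : c y ^ (ν : ℂ) = c y ^ (-β : ℂ) * c y ^ (⌊ν⌋₊ + 1) := by
      rw [← Complex.cpow_natCast, ← Complex.cpow_add _ _ hy]
      congr 1
      rw [hβdef]; push_cast; ring
    rw [h2, neg_pow]
    have h3 : ((-1 : ℂ)) ^ (⌊ν⌋₊ + 1) * (-1) ^ (⌊ν⌋₊ + 1) = 1 := by
      rw [← mul_pow]; simp
    push_cast
    linear_combination (W y * c y ^ (-β : ℂ) * c y ^ (⌊ν⌋₊ + 1) * Complex.exp (-t * c y)) * h3

end WeylDerivative

/-! ### Poisson process at an independent random time. -/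

section Subordination

variable {Ω : Type*} [MeasurableSpace Ω] {μ : Measure Ω}

/-- The right end point of the interval of the grid of mesh `1 / (n + 1)` containing `a`. -/
noncomputable def gridCeil (n : ℕ) (a : ℝ≥0) : ℝ≥0 :=
  ((⌊((n : ℝ≥0) + 1) * a⌋₊ : ℝ≥0) + 1) / ((n : ℝ≥0) + 1)

theorem le_gridCeil (n : ℕ) (a : ℝ≥0) : a ≤ gridCeil n a := by
  rw [gridCeil, le_div_iff₀ (by positivity), mul_comm]
  exact (Nat.lt_floor_add_one _).le

theorem gridCeil_le (n : ℕ) (a : ℝ≥0) : gridCeil n a ≤ a + 1 / ((n : ℝ≥0) + 1) := by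
  rw [gridCeil, add_div]
  gcongr
  rw [div_le_iff₀ (by positivity), mul_comm]
  exact Nat.floor_le (by positivity)

theorem tendsto_gridCeil (a : ℝ≥0) : Tendsto (fun n => gridCeil n a) atTop (𝓝 a) := by
  refine tendsto_of_tendsto_of_tendsto_of_le_of_le tendsto_const_nhds ?_
    (fun n => le_gridCeil n a) (fun n => gridCeil_le n a)
  simpa using tendsto_const_nhds.add (tendsto_one_div_add_atTop_nhds_zero_nat (𝕜 := ℝ≥0))

/-- Evaluation of an arbitrary path at a variable time is not jointly measurable; a time rounded to
the grid takes countably many values, so here it is. -/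
theorem measurableSet_eval_gridCeil_eq (n k : ℕ) :
    MeasurableSet {q : (ℝ≥0 → ℕ) × ℝ≥0 | q.1 (gridCeil n q.2) = k} := by
  have h1 : Measurable fun q : (ℝ≥0 → ℕ) × ℕ => q.1 (((q.2 : ℝ≥0) + 1) / ((n : ℝ≥0) + 1)) :=
    measurable_from_prod_countable_left fun j => measurable_pi_apply (((j : ℝ≥0) + 1) / ((n : ℝ≥0) + 1))
  have h2 : Measurable fun q : (ℝ≥0 → ℕ) × ℝ≥0 => (q.1, ⌊((n : ℝ≥0) + 1) * q.2⌋₊) :=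
    measurable_fst.prodMk (Nat.measurable_floor.comp (measurable_snd.const_mul _))
  exact (h1.comp h2) (measurableSet_singleton k)

theorem measurable_gridCeil (n : ℕ) : Measurable (gridCeil n) := by
  unfold gridCeil
  have : Measurable fun a : ℝ≥0 => ⌊((n : ℝ≥0) + 1) * a⌋₊ :=
    Nat.measurable_floor.comp (measurable_id.const_mul _)
  have h2 : Measurable fun j : ℕ => ((j : ℝ≥0) + 1) / ((n : ℝ≥0) + 1) := measurable_from_nat
  exact h2.comp this

/-- By independence the joint law of path and time is a product. Freezing the time leaves a Poisson
probability, which is then averaged over the time. -/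
theorem measureReal_gridCeil_eq [IsProbabilityMeasure μ] {rate : ℝ≥0} {N : ℝ≥0 → Ω → ℕ}
    (hN : IsPoissonProcess rate N μ) {a : Ω → ℝ≥0} (ha : Measurable a)
    (hNa : IndepFun (fun ω t => N t ω) a μ) (n k : ℕ) :
    MeasurableSet {ω | N (gridCeil n (a ω)) ω = k} ∧
    μ.real {ω | N (gridCeil n (a ω)) ω = k} =
      ∫ ω, (poissonMeasure (rate * gridCeil n (a ω))).real {k} ∂μ := by
  have hNm : Measurable fun ω t => N t ω := measurable_pi_lambda _ hN.measurable
  have hset := measurableSet_eval_gridCeil_eq n k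
  have hprod := (indepFun_iff_map_prod_eq_prod_map_map hNm.aemeasurable ha.aemeasurable).1 hNa
  have hmeas : MeasurableSet {ω | N (gridCeil n (a ω)) ω = k} := (hNm.prodMk ha) hset
  have := Measure.isProbabilityMeasure_map (μ := μ) hNm.aemeasurable
  have := Measure.isProbabilityMeasure_map (μ := μ) ha.aemeasurable
  have h1 : ∀ s, μ.map (fun ω t => N t ω) ((fun f => (f, s)) ⁻¹'
      {q : (ℝ≥0 → ℕ) × ℝ≥0 | q.1 (gridCeil n q.2) = k}) =
      poissonMeasure (rate * gridCeil n s) {k} := by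
    intro s
    rw [Measure.map_apply hNm (measurable_prodMk_right hset), ← hN.law,
      Measure.map_apply (hN.measurable _) (measurableSet_singleton k)]
    rfl
  have h2 : Measurable fun s => poissonMeasure (rate * gridCeil n s) {k} := by
    simp_rw [← h1]
    exact measurable_measure_prodMk_right hset
  refine ⟨hmeas, ?_⟩
  have h3 : μ {ω | N (gridCeil n (a ω)) ω = k} =
      ∫⁻ ω, poissonMeasure (rate * gridCeil n (a ω)) {k} ∂μ := by
    have : {ω | N (gridCeil n (a ω)) ω = k} = (fun ω => ((fun t => N t ω), a ω)) ⁻¹'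
      {q : (ℝ≥0 → ℕ) × ℝ≥0 | q.1 (gridCeil n q.2) = k} := rfl
    rw [this, ← Measure.map_apply (hNm.prodMk ha) hset, hprod, Measure.prod_apply_symm hset]
    simp_rw [h1]
    rw [lintegral_map h2 ha]
  simp only [measureReal_def]
  rw [h3]
  exact (integral_toReal (h2.comp ha).aemeasurable (Eventually.of_forall fun ω => by simp)).symm

/-- A Poisson process evaluated at an independent random time has a mixed Poisson law. -/
theorem measureReal_poisson_comp_eq [IsProbabilityMeasure μ] {rate : ℝ≥0} {N : ℝ≥0 → Ω → ℕ}
    (hN : IsPoissonProcess rate N μ) {a : Ω → ℝ≥0} (ha : Measurable a)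
    (hNa : IndepFun (fun ω t => N t ω) a μ) (k : ℕ) :
    μ.real {ω | N (a ω) ω = k} =
      (∫ ω, (a ω : ℝ) ^ k * Real.exp (-rate * a ω) ∂μ) * ((rate : ℝ) ^ k / k.factorial) := by
  have hgrid := fun n => measureReal_gridCeil_eq hN ha hNa n k
  -- Grid times approach a(ω) from the right, where the path is right-continuous; being integer
  -- valued, it is eventually constant along them.
  have hae : ∀ᵐ ω ∂μ, ∀ᶠ n in atTop, N (gridCeil n (a ω)) ω = N (a ω) ω := by
    filter_upwards [hN.subordinator.paths] with ω hω
    have h1 : Tendsto (fun n => gridCeil n (a ω)) atTop (𝓝[≥] (a ω)) :=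
      tendsto_nhdsWithin_iff.2 ⟨tendsto_gridCeil _, Eventually.of_forall fun n => le_gridCeil _ _⟩
    have h2 := (hω.2 (a ω)).tendsto.comp h1
    have h3 : Tendsto (fun n => N (gridCeil n (a ω)) ω) atTop (𝓝 (N (a ω) ω)) :=
      Nat.isClosedEmbedding_coe_real.isEmbedding.tendsto_nhds_iff.2 h2
    simpa [nhds_discrete] using h3
  have hind : ∀ᵐ ω ∂μ, Tendsto
      (fun n => {ω | N (gridCeil n (a ω)) ω = k}.indicator (fun _ => (1 : ℝ)) ω) atTop
      (𝓝 ({ω | N (a ω) ω = k}.indicator (fun _ => (1 : ℝ)) ω)) := by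
    filter_upwards [hae] with ω hω
    refine tendsto_const_nhds.congr' ?_
    filter_upwards [hω] with n hn
    simp only [indicator, mem_ofPred_eq, hn]
  have hbound : ∀ (S : Set Ω) ω, ‖S.indicator (fun _ => (1 : ℝ)) ω‖ ≤ 1 := by
    intro S ω
    by_cases h : ω ∈ S <;> simp [h]
  have hmeas : ∀ n, AEStronglyMeasurable
      ({ω | N (gridCeil n (a ω)) ω = k}.indicator fun _ => (1 : ℝ)) μ :=
    fun n => (aestronglyMeasurable_const).indicator (hgrid n).1
  have hlim := tendsto_integral_of_dominated_convergence (fun _ => (1 : ℝ)) hmeas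
    (integrable_const _) (fun n => Eventually.of_forall (hbound _)) hind
  -- The event at the exact time is known to be measurable only up to a null set, as an almost sure
  -- limit of measurable indicators.
  have hnull : NullMeasurableSet {ω | N (a ω) ω = k} μ := by
    have h1 : AEMeasurable ({ω | N (a ω) ω = k}.indicator fun _ => (1 : ℝ)) μ :=
      aemeasurable_of_tendsto_metrizable_ae atTop (fun n => (hmeas n).aemeasurable) hind
    have h2 := h1.nullMeasurable (measurableSet_singleton (1 : ℝ))
    convert h2 using 1
    ext ω
    by_cases h : N (a ω) ω = k <;> simp [indicator, h]
  have hval : ∫ ω, {ω | N (a ω) ω = k}.indicator (fun _ => (1 : ℝ)) ω ∂μ =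
      μ.real {ω | N (a ω) ω = k} := by
    rw [integral_indicator₀ hnull]; simp
  rw [hval] at hlim
  have hlim2 : Tendsto (fun n => ∫ ω, (poissonMeasure (rate * gridCeil n (a ω))).real {k} ∂μ)
      atTop (𝓝 (∫ ω, (poissonMeasure (rate * a ω)).real {k} ∂μ)) := by
    have hcont : Continuous fun s : ℝ≥0 => (poissonMeasure (rate * s)).real {k} := by
      simp only [poissonMeasure_real_singleton]
      fun_prop
    refine tendsto_integral_of_dominated_convergence (fun _ => (1 : ℝ)) (fun n => ?_)
      (integrable_const _) (fun n => Eventually.of_forall fun ω => ?_)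
      (Eventually.of_forall fun ω => ?_)
    · exact (hcont.measurable.comp ((measurable_gridCeil n).comp ha)).aestronglyMeasurable
    · rw [Real.norm_of_nonneg measureReal_nonneg]
      exact measureReal_le_one
    · exact (hcont.tendsto _).comp (tendsto_gridCeil _)
  have heq : ∀ n, ∫ ω, {ω | N (gridCeil n (a ω)) ω = k}.indicator (fun _ => (1 : ℝ)) ω ∂μ =
      ∫ ω, (poissonMeasure (rate * gridCeil n (a ω))).real {k} ∂μ := by
    intro n
    rw [← (hgrid n).2, integral_indicator (hgrid n).1]; simp
  simp_rw [heq] at hlim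
  rw [tendsto_nhds_unique hlim hlim2, ← integral_mul_const]
  refine integral_congr_ae (Eventually.of_forall fun ω => ?_)
  simp only [poissonMeasure_real_singleton]
  push_cast
  rw [mul_pow, neg_mul]
  ring

end Subordination

/-! ### Principal complex powers. -/

section Cpow

theorem re_cpow_ofReal (z : ℂ) (a : ℝ) :
    (z ^ (a : ℂ)).re = ‖z‖ ^ a * Real.cos (Complex.arg z * a) := by
  rw [Complex.cpow_ofReal, Complex.re_ofReal_mul, Complex.add_re, Complex.ofReal_re,
    Complex.re_ofReal_mul, Complex.I_re, mul_zero, add_zero]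

/-- Raising to a power a ∈ [0, 1] shrinks the argument in absolute value, so the cosine can only
grow. -/
theorem cos_arg_mul_norm_cpow_le {z : ℂ} {a : ℝ} (ha0 : 0 ≤ a) (ha1 : a ≤ 1) :
    Real.cos (Complex.arg z) * ‖z ^ (a : ℂ)‖ ≤ (z ^ (a : ℂ)).re := by
  rw [re_cpow_ofReal, Complex.norm_cpow_real, mul_comm]
  gcongr
  rw [← Real.cos_abs (Complex.arg z), ← Real.cos_abs (Complex.arg z * a)]
  refine Real.cos_le_cos_of_nonneg_of_le_pi (abs_nonneg _) (Complex.abs_arg_le_pi z) ?_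
  rw [abs_mul, abs_of_nonneg ha0]
  exact mul_le_of_le_one_right (abs_nonneg _) ha1

theorem cpow_cpow_inv {z : ℂ} {a : ℝ} (ha0 : 0 < a) (ha1 : a ≤ 1) :
    (z ^ (a : ℂ)) ^ ((1 / a : ℝ) : ℂ) = z := by
  have him : (Complex.log z * a).im = Complex.arg z * a := by
    rw [Complex.im_mul_ofReal, Complex.log_im]
  have habs : |Complex.arg z * a| ≤ |Complex.arg z| := by
    rw [abs_mul, abs_of_pos ha0]
    exact mul_le_of_le_one_right (abs_nonneg _) ha1
  rw [← Complex.cpow_mul]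
  · rw [← Complex.ofReal_mul, mul_one_div_cancel ha0.ne']; simp
  · rw [him]
    have h1 := Complex.neg_pi_lt_arg z
    rcases le_or_gt 0 (Complex.arg z) with h | h
    · nlinarith [mul_nonneg h ha0.le, Real.pi_pos]
    · nlinarith
  · rw [him]
    exact (le_abs_self _).trans (habs.trans (Complex.abs_arg_le_pi z))

/-- The Gamma quotient is the falling factorial a(a - 1)⋯(a - k + 1). Excluding integers keeps every
a - k nonzero, so the functional equation of Gamma applies at each step. -/
theorem iteratedDeriv_cpow_const {a : ℝ} (ha0 : 0 < a) (ha : ∀ n : ℕ, a ≠ n) (k : ℕ) {z : ℂ}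
    (hz : z ∈ Complex.slitPlane) :
    iteratedDeriv k (fun z : ℂ => z ^ (a : ℂ)) z =
      ((Real.Gamma (a + 1) / Real.Gamma (a + 1 - k) : ℝ) : ℂ) * z ^ ((a : ℂ) - k) := by
  induction k generalizing z with
  | zero =>
    have : Real.Gamma (a + 1) ≠ 0 := (Real.Gamma_pos_of_pos (by linarith)).ne'
    simp [this]
  | succ k ih =>
    have hev : iteratedDeriv k (fun z : ℂ => z ^ (a : ℂ)) =ᶠ[𝓝 z] fun z =>
        ((Real.Gamma (a + 1) / Real.Gamma (a + 1 - k) : ℝ) : ℂ) * z ^ ((a : ℂ) - k) := by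
      filter_upwards [Complex.isOpen_slitPlane.mem_nhds hz] with w hw using ih hw
    have hne : a - k ≠ 0 := sub_ne_zero.2 (ha k)
    have hG : Real.Gamma (a + 1 - k) = (a - k) * Real.Gamma (a + 1 - (k + 1 : ℕ)) := by
      rw [show a + 1 - k = (a - k) + 1 by ring, Real.Gamma_add_one hne]
      congr 2
      push_cast; ring
    have hd : HasDerivAt (fun z : ℂ => z ^ ((a : ℂ) - k))
        (((a : ℂ) - k) * z ^ ((a : ℂ) - k - 1) * 1) z := (hasDerivAt_id z).cpow_const hz
    rw [iteratedDeriv_succ, hev.deriv_eq, (hd.const_mul _).deriv, hG]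
    have hne' : (a : ℂ) - k ≠ 0 := by exact_mod_cast hne
    push_cast
    rw [show (a : ℂ) - (k + 1) = (a : ℂ) - k - 1 by ring, mul_one, ← mul_assoc]
    congr 1
    rw [div_mul_eq_div_div, div_right_comm, div_mul_cancel₀ _ hne']

end Cpow

/-! ### Cauchy's formula on a circle inside the right half plane. -/

section CircleRepresentation

/-- The weight which represents `(-l) ^ k / k! * f⁽ᵏ⁾(l)` as an average of `f` over the circle of
center `l` and radius `l / 2`. -/
noncomputable def circleWeight (l : ℝ) (k : ℕ) (θ : ℝ) : ℂ :=
  1 / (2 * Real.pi) * (-l / circleMap 0 (l / 2) θ) ^ k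

variable {l : ℝ}

theorem continuous_circleWeight (hl : 0 < l) (k : ℕ) : Continuous (circleWeight l k) := by
  unfold circleWeight
  refine continuous_const.mul ((continuous_const.div (continuous_circleMap _ _) fun θ => ?_).pow k)
  exact circleMap_ne_center (by positivity)

/-- Cauchy's formula for the k-th derivative: with w = z - l, dz = i w dθ cancels one of the k + 1
powers of w in the denominator. -/
theorem integral_circleWeight_mul (hl : 0 < l) (k : ℕ) {f : ℂ → ℂ}
    (hf : DifferentiableOn ℂ f (Metric.closedBall (l : ℂ) (l / 2))) :
    ∫ θ in Ioc 0 (2 * Real.pi), circleWeight l k θ * f (circleMap l (l / 2) θ) =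
      (-l) ^ k / k.factorial * iteratedDeriv k f l := by
  have h := hf.circleIntegral_one_div_sub_center_pow_smul (half_pos hl) k
  have hfac : (k.factorial : ℂ) ≠ 0 := by exact_mod_cast k.factorial_ne_zero
  have hpi : (2 * Real.pi * Complex.I : ℂ) ≠ 0 := Complex.two_pi_I_ne_zero
  have h2 : iteratedDeriv k f l = k.factorial / (2 * Real.pi * Complex.I) *
      ∮ z in C((l : ℂ), l / 2), (1 / (z - l) ^ (k + 1)) • f z := by
    rw [h, smul_eq_mul]
    field_simp
  rw [h2, circleIntegral, intervalIntegral.integral_of_le Real.two_pi_pos.le, ← mul_assoc,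
    ← integral_const_mul]
  refine integral_congr_ae (Eventually.of_forall fun θ => ?_)
  have hw : circleMap 0 (l / 2) θ ≠ 0 := circleMap_ne_center (by positivity)
  have hI := Complex.I_ne_zero
  have hpi' : (Real.pi : ℂ) ≠ 0 := by exact_mod_cast Real.pi_ne_zero
  simp only [smul_eq_mul, deriv_circleMap, circleMap_sub_center, circleWeight]
  rw [div_pow]
  field_simp
  ring

theorem circleMap_mem (hl : 0 < l) (θ : ℝ) :
    circleMap l (l / 2) θ ∈ Metric.closedBall (l : ℂ) (l / 2) :=
  circleMap_mem_closedBall _ (by positivity) θ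

theorem half_le_re_of_mem_closedBall {z : ℂ} (hz : z ∈ Metric.closedBall (l : ℂ) (l / 2)) :
    l / 2 ≤ z.re := by
  rw [mem_closedBall_iff_norm] at hz
  have := (Complex.abs_re_le_norm _).trans hz
  rw [Complex.sub_re, Complex.ofReal_re, abs_le] at this
  linarith [this.1]

theorem mem_slitPlane_of_mem_closedBall (hl : 0 < l) {z : ℂ}
    (hz : z ∈ Metric.closedBall (l : ℂ) (l / 2)) : z ∈ Complex.slitPlane :=
  Or.inl (lt_of_lt_of_le (by positivity) (half_le_re_of_mem_closedBall hz))

/-- On the disc Re z ≥ l/2 and |z| ≤ 3l/2, so the cosine is at least 1/3. This is the sector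
constant for the circle. -/
theorem third_le_cos_arg (hl : 0 < l) {z : ℂ} (hz : z ∈ Metric.closedBall (l : ℂ) (l / 2)) :
    1 / 3 ≤ Real.cos (Complex.arg z) := by
  have h0 : z ≠ 0 := Complex.slitPlane_ne_zero (mem_slitPlane_of_mem_closedBall hl hz)
  have h1 : ‖z‖ ≤ 3 * l / 2 := by
    have h2 : ‖z - l‖ ≤ l / 2 := mem_closedBall_iff_norm.1 hz
    have h3 := norm_add_le (z - l) l
    rw [sub_add_cancel, Complex.norm_real, Real.norm_of_nonneg hl.le] at h3
    linarith
  rw [Complex.cos_arg h0, le_div_iff₀ (norm_pos_iff.2 h0)]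
  linarith [half_le_re_of_mem_closedBall hz]

theorem continuous_circleMap_cpow (hl : 0 < l) (a : ℂ) :
    Continuous fun θ : ℝ => circleMap (l : ℂ) (l / 2) θ ^ a :=
  (continuous_circleMap _ _).cpow continuous_const
    fun θ => mem_slitPlane_of_mem_closedBall hl (circleMap_mem hl θ)

theorem differentiableOn_cexp_mul_cpow (hl : 0 < l) (t : ℝ) (a : ℂ) :
    DifferentiableOn ℂ (fun z : ℂ => Complex.exp (-t * z ^ a))
      (Metric.closedBall (l : ℂ) (l / 2)) := fun _ hz =>
  (((differentiableAt_id.cpow_const (mem_slitPlane_of_mem_closedBall hl hz)).const_mul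
    _).cexp).differentiableWithinAt

end CircleRepresentation

/-! ### The law of the subordinated Poisson process. -/

section SubordinatedLaw

variable {Ω : Type*} [MeasurableSpace Ω] {μ : Measure Ω} {α : ℝ} {A : ℝ≥0 → Ω → ℝ≥0}

theorem IsStableSubordinator.integrable_exp [IsFiniteMeasure μ]
    (hA : IsStableSubordinator α A μ) (t : ℝ≥0) {ξ : ℝ} (hξ : 0 < ξ) :
    Integrable (fun ω => Real.exp (-ξ * (A t ω : ℝ))) μ := by
  have hm : Measurable fun ω => (A t ω : ℝ) := (hA.measurable t).coe_nnreal_real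
  refine (integrable_const (1 : ℝ)).mono'
    (hm.const_mul (-ξ)).exp.aestronglyMeasurable (Eventually.of_forall fun ω => ?_)
  rw [Real.norm_of_nonneg (Real.exp_nonneg _), Real.exp_le_one_iff]
  have := (A t ω).coe_nonneg
  nlinarith

theorem IsStableSubordinator.complexLaplace [IsFiniteMeasure μ]
    (hA : IsStableSubordinator α A μ) (t : ℝ≥0) {z : ℂ} (hz : 0 < z.re) :
    ∫ ω, Complex.exp (-z * (A t ω : ℝ)) ∂μ = Complex.exp (-(t : ℝ) * z ^ (α : ℂ)) := by
  refine integral_cexp_neg_mul_eq (X := fun ω => (A t ω : ℝ))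
    (fun ξ hξ => hA.integrable_exp t hξ)
    (G := fun z => Complex.exp (-(t : ℝ) * z ^ (α : ℂ))) (fun z hz => ?_) (fun ξ hξ => ?_) hz
  · exact (((differentiableAt_id.cpow_const (Or.inl hz)).const_mul _).cexp).differentiableWithinAt
  · rw [hA.laplace t ξ hξ.le, ← Complex.ofReal_cpow hξ.le]
    push_cast
    rfl

/-- Each derivative of the Laplace transform brings down a factor -A_t. -/
theorem IsStableSubordinator.integral_pow_mul_exp [IsFiniteMeasure μ]
    (hA : IsStableSubordinator α A μ) (t : ℝ≥0) (k : ℕ) {l : ℝ} (hl : 0 < l) :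
    ((∫ ω, (A t ω : ℝ) ^ k * Real.exp (-l * (A t ω : ℝ)) ∂μ : ℝ) : ℂ) =
      (-1) ^ k * iteratedDeriv k (fun z : ℂ => Complex.exp (-(t : ℝ) * z ^ (α : ℂ))) l := by
  have hint := subset_interior_integrableExpSet (μ := μ) (X := fun ω => (A t ω : ℝ))
    (fun ξ hξ => hA.integrable_exp t hξ)
  have h1 := iteratedDeriv_complexMGF (μ := μ) (X := fun ω => (A t ω : ℝ)) (z := -(l : ℂ))
    (hint (by simpa using hl)) k
  have hev : (fun z : ℂ => Complex.exp (-(t : ℝ) * z ^ (α : ℂ))) =ᶠ[𝓝 (l : ℂ)]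
      fun z => complexMGF (fun ω => (A t ω : ℝ)) μ (-z) := by
    have : {z : ℂ | 0 < z.re} ∈ 𝓝 (l : ℂ) :=
      (isOpen_lt continuous_const Complex.continuous_re).mem_nhds (by simpa using hl)
    filter_upwards [this] with z hz
    exact (hA.complexLaplace t hz).symm
  rw [hev.iteratedDeriv_eq, iteratedDeriv_comp_neg, h1, smul_eq_mul, ← mul_assoc, ← mul_pow,
    neg_one_mul, neg_neg, one_pow, one_mul, ← integral_complex_ofReal]
  push_cast
  rfl

theorem countingLaw_comp_eq_integral_circle [IsProbabilityMeasure μ] {rate : ℝ≥0}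
    (hrate : 0 < rate) {N : ℝ≥0 → Ω → ℕ} (hN : IsPoissonProcess rate N μ)
    (hA : IsStableSubordinator α A μ)
    (hNA : IndepFun (fun ω t => N t ω) (fun ω t => A t ω) μ) (k : ℕ) {t : ℝ} (ht : 0 ≤ t) :
    countingLaw μ (fun t ω => N (A t ω) ω) k t =
      (∫ θ in Ioc 0 (2 * Real.pi), circleWeight rate k θ *
        Complex.exp (-t * circleMap (rate : ℝ) (rate / 2) θ ^ (α : ℂ))).re := by
  have hrate' : (0 : ℝ) < rate := by exact_mod_cast hrate
  have hNa : IndepFun (fun ω t => N t ω) (A t.toNNReal) μ :=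
    hNA.comp measurable_id (measurable_pi_apply t.toNNReal)
  have h1 := measureReal_poisson_comp_eq hN (hA.measurable t.toNNReal) hNa k
  have h2 := hA.integral_pow_mul_exp t.toNNReal k hrate'
  rw [Real.coe_toNNReal t ht] at h2
  have h3 := integral_circleWeight_mul hrate' k
    (differentiableOn_cexp_mul_cpow hrate' t (α : ℂ))
  have h4 : countingLaw μ (fun t ω => N (A t ω) ω) k t =
      μ.real {ω | N (A t.toNNReal ω) ω = k} := by
    simp [countingLaw]
  rw [h4, h1, h3, ← Complex.ofReal_re (_ * _)]
  congr 1
  rw [Complex.ofReal_mul, h2]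
  push_cast
  rw [neg_pow]
  ring

theorem countingLaw_comp_zero [IsProbabilityMeasure μ] {rate : ℝ≥0}
    {N : ℝ≥0 → Ω → ℕ} (hN : IsPoissonProcess rate N μ)
    (hA : IsStableSubordinator α A μ)
    (hNA : IndepFun (fun ω t => N t ω) (fun ω t => A t ω) μ) (k : ℕ) :
    countingLaw μ (fun t ω => N (A t ω) ω) k 0 = if k = 0 then 1 else 0 := by
  have hNa : IndepFun (fun ω t => N t ω) (A 0) μ :=
    hNA.comp measurable_id (measurable_pi_apply (0 : ℝ≥0))
  have h1 := measureReal_poisson_comp_eq hN (hA.measurable 0) hNa k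
  have h4 : countingLaw μ (fun t ω => N (A t ω) ω) k 0 = μ.real {ω | N (A 0 ω) ω = k} := by
    simp [countingLaw]
  have h5 : ∫ ω, (A 0 ω : ℝ) ^ k * Real.exp (-rate * A 0 ω) ∂μ = 0 ^ k := by
    have : ∫ ω, (A 0 ω : ℝ) ^ k * Real.exp (-rate * A 0 ω) ∂μ = ∫ _, (0 : ℝ) ^ k ∂μ := by
      refine integral_congr_ae ?_
      filter_upwards [hA.subordinator.zero] with ω hω
      simp [hω]
    rw [this]; simp
  rw [h4, h1, h5]
  rcases Nat.eq_zero_or_pos k with rfl | hk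
  · simp
  · simp [hk.ne']

variable {l : ℝ}

theorem third_mul_norm_circleMap_cpow_le (hl : 0 < l) (hα0 : 0 < α) (hα1 : α ≤ 1) (θ : ℝ) :
    1 / 3 * ‖circleMap (l : ℂ) (l / 2) θ ^ (α : ℂ)‖ ≤
      (circleMap (l : ℂ) (l / 2) θ ^ (α : ℂ)).re :=
  (mul_le_mul_of_nonneg_right (third_le_cos_arg hl (circleMap_mem hl θ)) (norm_nonneg _)).trans
    (cos_arg_mul_norm_cpow_le hα0.le hα1)

theorem circleMap_cpow_ne_zero (hl : 0 < l) (a : ℂ) (θ : ℝ) :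
    circleMap (l : ℂ) (l / 2) θ ^ a ≠ 0 := by
  have := Complex.slitPlane_ne_zero (mem_slitPlane_of_mem_closedBall hl (circleMap_mem hl θ))
  simp [Complex.cpow_eq_zero_iff, this]

theorem integrable_circleWeight_mul (hl : 0 < l) (k : ℕ) (x b : ℝ) :
    Integrable (fun θ => ‖circleWeight l k θ‖ * ‖circleMap (l : ℂ) (l / 2) θ ^ (α : ℂ)‖ ^ b *
      Real.exp (-x * (circleMap (l : ℂ) (l / 2) θ ^ (α : ℂ)).re))
      (volume.restrict (Ioc 0 (2 * Real.pi))) := by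
  have hc := continuous_circleMap_cpow hl (α : ℂ)
  refine Continuous.integrableOn_Ioc ?_
  refine ((continuous_circleWeight hl k).norm.mul (hc.norm.rpow_const fun θ => Or.inl ?_)).mul
    (Real.continuous_exp.comp (continuous_const.mul (Complex.continuous_re.comp hc)))
  exact norm_ne_zero_iff.2 (circleMap_cpow_ne_zero hl _ θ)

/-- Write z = l + w. For k ≥ 1, w times the weight of index k is -l times the weight of index k - 1,
which is the shift. For k = 0 the extra term is the mean over the circle of (z - l) exp(-t z^a),
which is its value 0 at the center. -/
theorem integral_circleWeight_mul_center (hl : 0 < l) (k : ℕ) (t : ℝ) (a : ℂ) :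
    ∫ θ in Ioc 0 (2 * Real.pi), circleWeight l k θ * circleMap (l : ℂ) (l / 2) θ *
        Complex.exp (-t * circleMap l (l / 2) θ ^ a) =
      l * ((∫ θ in Ioc 0 (2 * Real.pi), circleWeight l k θ *
          Complex.exp (-t * circleMap l (l / 2) θ ^ a)) -
        if k = 0 then 0 else ∫ θ in Ioc 0 (2 * Real.pi), circleWeight l (k - 1) θ *
          Complex.exp (-t * circleMap l (l / 2) θ ^ a)) := by
  have hcexp : Continuous fun θ : ℝ => Complex.exp (-t * circleMap (l : ℂ) (l / 2) θ ^ a) :=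
    Complex.continuous_exp.comp (continuous_const.mul (continuous_circleMap_cpow hl a))
  have hint : ∀ k, IntegrableOn (fun θ : ℝ => circleWeight l k θ *
      Complex.exp (-t * circleMap (l : ℂ) (l / 2) θ ^ a)) (Ioc 0 (2 * Real.pi)) :=
    fun k => ((continuous_circleWeight hl k).mul hcexp).integrableOn_Ioc
  rcases Nat.eq_zero_or_pos k with rfl | hk
  · have h1 := integral_circleWeight_mul hl 0
      (((differentiable_id.sub_const (l : ℂ)).differentiableOn).mul
        (differentiableOn_cexp_mul_cpow hl t a))
    simp only [Pi.mul_apply, id, pow_zero, Nat.factorial_zero, Nat.cast_one, div_one, one_mul,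
      iteratedDeriv_zero, sub_self, zero_mul] at h1
    rw [if_pos rfl, sub_zero, ← integral_const_mul, ← sub_eq_zero, ← integral_sub]
    · rw [← h1]
      refine integral_congr_ae (Eventually.of_forall fun θ => ?_)
      simp only
      ring
    · exact (((continuous_circleWeight hl 0).mul (continuous_circleMap _ _)).mul
        hcexp).integrableOn_Ioc
    · exact (hint 0).const_mul _
  · obtain ⟨n, rfl⟩ : ∃ n, k = n + 1 := ⟨k - 1, by omega⟩
    rw [if_neg (by omega), Nat.add_sub_cancel, ← integral_sub (hint _) (hint _),
      ← integral_const_mul]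
    refine integral_congr_ae (Eventually.of_forall fun θ => ?_)
    have hw : circleMap 0 (l / 2) θ ≠ 0 := circleMap_ne_center (by positivity)
    have hz : circleMap (l : ℂ) (l / 2) θ = l + circleMap 0 (l / 2) θ := by
      simp [circleMap]
    have hstep : circleWeight l (n + 1) θ * circleMap 0 (l / 2) θ = -l * circleWeight l n θ := by
      simp only [circleWeight, pow_succ]
      field_simp
    simp only
    nth_rewrite 1 [hz]
    linear_combination Complex.exp (-t * circleMap l (l / 2) θ ^ a) * hstep

theorem hasRLDeriv_integral_circle (hl : 0 < l) (hα0 : 0 < α) (hα1 : α ≤ 1) (k : ℕ)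
    {f : ℝ → ℝ} (hf : ∀ s : ℝ, 0 < s → f s = (∫ θ in Ioc 0 (2 * Real.pi), circleWeight l k θ *
        Complex.exp (-s * circleMap l (l / 2) θ ^ (α : ℂ))).re) {t : ℝ} (ht : 0 < t) :
    HasRLDeriv (1 / α) f t (l * ((∫ θ in Ioc 0 (2 * Real.pi), circleWeight l k θ *
          Complex.exp (-t * circleMap l (l / 2) θ ^ (α : ℂ))).re -
        if k = 0 then 0 else (∫ θ in Ioc 0 (2 * Real.pi), circleWeight l (k - 1) θ *
          Complex.exp (-t * circleMap l (l / 2) θ ^ (α : ℂ))).re)) := by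
  have h := hasRLDeriv_re_integral (m := volume.restrict (Ioc 0 (2 * Real.pi))) (ν := 1 / α)
    (W := circleWeight l k) (κ := 1 / 3) (by norm_num)
    (continuous_circleMap_cpow hl (α : ℂ)).measurable
    (continuous_circleWeight hl k).aestronglyMeasurable
    (Eventually.of_forall (third_mul_norm_circleMap_cpow_le hl hα0 hα1))
    (Eventually.of_forall (circleMap_cpow_ne_zero hl _))
    (fun x _ => integrable_circleWeight_mul hl k x _) hf ht
  convert h using 1
  simp only [cpow_cpow_inv hα0 hα1]
  rw [integral_circleWeight_mul_center hl, Complex.re_ofReal_mul, Complex.sub_re]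
  split_ifs <;> rfl

/-- The interval reaches below 0 so that the derivatives at t = 0 are two-sided derivatives of an
extension. -/
theorem contDiffOn_integral_circle (hl : 0 < l) (hα0 : 0 < α) (hα1 : α ≤ 1) (k : ℕ) :
    ContDiffOn ℝ (⊤ : ℕ∞) (fun s : ℝ => (∫ θ in Ioc 0 (2 * Real.pi), circleWeight l k θ *
        Complex.exp (-s * circleMap l (l / 2) θ ^ (α : ℂ))).re) (Ioi (-1)) :=
  contDiffOn_re_integral (κ := 1 / 3) (by norm_num)
    (continuous_circleMap_cpow hl (α : ℂ)).measurable
    (continuous_circleWeight hl k).aestronglyMeasurable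
    (Eventually.of_forall (third_mul_norm_circleMap_cpow_le hl hα0 hα1))
    (fun x _ => by simpa using integrable_circleWeight_mul (α := α) hl k x 0)

theorem iteratedDeriv_integral_circle_zero (hl : 0 < l) (hα0 : 0 < α) (hα1 : α ≤ 1) (k j : ℕ)
    (hj : 1 ≤ j) (hjα : α * j < 1) :
    iteratedDeriv j (fun s : ℝ => (∫ θ in Ioc 0 (2 * Real.pi), circleWeight l k θ *
        Complex.exp (-s * circleMap l (l / 2) θ ^ (α : ℂ))).re) 0 =
      (-1) ^ (k + j) * (l ^ (α * j) / (Nat.factorial k : ℝ)) *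
          (Real.Gamma (α * j + 1) / Real.Gamma (α * j + 1 - k)) := by
  rw [iteratedDeriv_re_integral (κ := 1 / 3) (a := -1) (by norm_num)
    (continuous_circleMap_cpow hl (α : ℂ)).measurable
    (continuous_circleWeight hl k).aestronglyMeasurable
    (Eventually.of_forall (third_mul_norm_circleMap_cpow_le hl hα0 hα1))
    (fun x _ => by simpa using integrable_circleWeight_mul (α := α) hl k x 0) j (by norm_num)]
  have ha0 : 0 < α * j := mul_pos hα0 (by exact_mod_cast hj)
  -- The exponent αj lies strictly between 0 and 1, hence is no integer.
  have ha : ∀ n : ℕ, α * j ≠ n := by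
    rintro (_ | n) h
    · simp only [Nat.cast_zero] at h; linarith
    · have : (1 : ℝ) ≤ ((n + 1 : ℕ) : ℝ) := by exact_mod_cast Nat.le_add_left 1 n
      linarith
  have hl' : (l : ℂ) ∈ Complex.slitPlane := Or.inl (by simpa using hl)
  have h1 := integral_circleWeight_mul hl k (f := fun z => z ^ ((α * j : ℝ) : ℂ))
    fun z hz => (differentiableAt_id.cpow_const
      (mem_slitPlane_of_mem_closedBall hl hz)).differentiableWithinAt
  rw [iteratedDeriv_cpow_const ha0 ha k hl'] at h1
  have h2 : ∫ θ in Ioc 0 (2 * Real.pi), circleWeight l k θ *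
      (-circleMap (l : ℂ) (l / 2) θ ^ (α : ℂ)) ^ j *
      Complex.exp (-(0 : ℝ) * circleMap (l : ℂ) (l / 2) θ ^ (α : ℂ)) =
      (-1) ^ j * ∫ θ in Ioc 0 (2 * Real.pi), circleWeight l k θ *
        circleMap (l : ℂ) (l / 2) θ ^ ((α * j : ℝ) : ℂ) := by
    rw [← integral_const_mul]
    refine integral_congr_ae (Eventually.of_forall fun θ => ?_)
    simp only
    rw [neg_pow, Complex.ofReal_mul, mul_comm (α : ℂ), Complex.ofReal_natCast,
      Complex.cpow_nat_mul]
    simp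
    ring
  rw [h2, h1, ← Complex.ofReal_re (_ * (_ / _))]
  congr 1
  have h3 : (l : ℂ) ^ (((α * j : ℝ) : ℂ) - k) = ((l ^ (α * j) / l ^ k : ℝ) : ℂ) := by
    rw [← Complex.ofReal_natCast, ← Complex.ofReal_sub, ← Complex.ofReal_cpow hl.le,
      Real.rpow_sub_natCast hl.ne']
  rw [h3]
  have hl0 : (l : ℂ) ≠ 0 := by exact_mod_cast hl.ne'
  push_cast
  rw [neg_pow (l : ℂ), pow_add]
  field_simp

end SubordinatedLaw

/-! ### The stable density as an integral along a ray. -/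

section StableDensity

/-- The point at distance `r` from the origin on the ray of argument `θ`. -/
noncomputable def rayPoint (θ r : ℝ) : ℂ := r * Complex.exp (θ * Complex.I)

/-- The constant `e ^ (iθ) / (iπ)`. -/
noncomputable def rayFactor (θ : ℝ) : ℂ := -Complex.I / Real.pi * Complex.exp (θ * Complex.I)

/-- The density of the stable subordinator: inverse Laplace transform of `exp (-t s ^ α)`, with the
Bromwich line folded onto the two rays of arguments `± θ`. -/
noncomputable def stableDensity (α θ x t : ℝ) : ℝ :=
  (∫ r in Ioi (0 : ℝ), rayFactor θ * Complex.exp (x * rayPoint θ r) *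
    Complex.exp (-t * rayPoint θ r ^ (α : ℂ))).re

variable {α θ : ℝ}

theorem continuous_rayPoint (θ : ℝ) : Continuous (rayPoint θ) := by
  unfold rayPoint; fun_prop

theorem norm_rayPoint (θ : ℝ) {r : ℝ} (hr : 0 ≤ r) : ‖rayPoint θ r‖ = r := by
  rw [rayPoint, norm_mul, Complex.norm_exp_ofReal_mul_I, Complex.norm_real, mul_one,
    Real.norm_of_nonneg hr]

theorem rayPoint_ne_zero (θ : ℝ) {r : ℝ} (hr : 0 < r) : rayPoint θ r ≠ 0 := by
  rw [← norm_ne_zero_iff, norm_rayPoint θ hr.le]; exact hr.ne'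

theorem re_rayPoint (θ r : ℝ) : (rayPoint θ r).re = r * Real.cos θ := by
  rw [rayPoint, Complex.re_ofReal_mul, Complex.exp_ofReal_mul_I_re]

theorem im_rayPoint (θ r : ℝ) : (rayPoint θ r).im = r * Real.sin θ := by
  rw [rayPoint, Complex.im_ofReal_mul, Complex.exp_ofReal_mul_I_im]

theorem arg_rayPoint (hθ0 : -Real.pi < θ) (hθ1 : θ ≤ Real.pi) {r : ℝ} (hr : 0 < r) :
    Complex.arg (rayPoint θ r) = θ := by
  rw [rayPoint, Complex.exp_mul_I]
  exact Complex.arg_mul_cos_add_sin_mul_I hr ⟨hθ0, hθ1⟩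

theorem norm_rayPoint_cpow (θ a : ℝ) {r : ℝ} (hr : 0 ≤ r) :
    ‖rayPoint θ r ^ (a : ℂ)‖ = r ^ a := by
  rw [Complex.norm_cpow_real, norm_rayPoint θ hr]

theorem re_rayPoint_cpow (hθ0 : -Real.pi < θ) (hθ1 : θ ≤ Real.pi) (a : ℝ) {r : ℝ} (hr : 0 < r) :
    (rayPoint θ r ^ (a : ℂ)).re = Real.cos (a * θ) * r ^ a := by
  rw [re_cpow_ofReal, arg_rayPoint hθ0 hθ1 hr, norm_rayPoint θ hr.le, mul_comm θ, mul_comm]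

theorem rayPoint_cpow (hθ0 : -Real.pi < θ) (hθ1 : θ ≤ Real.pi) (a : ℝ) {r : ℝ} (hr : 0 < r) :
    rayPoint θ r ^ (a : ℂ) = (r ^ a : ℝ) * Complex.exp ((a * θ : ℝ) * Complex.I) := by
  rw [Complex.cpow_ofReal, arg_rayPoint hθ0 hθ1 hr, norm_rayPoint θ hr.le, Complex.exp_mul_I,
    mul_comm θ]
  push_cast
  rfl

theorem norm_rayFactor (θ : ℝ) : ‖rayFactor θ‖ = 1 / Real.pi := by
  rw [rayFactor, norm_mul, Complex.norm_exp_ofReal_mul_I, norm_div, norm_neg, Complex.norm_I,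
    Complex.norm_real, Real.norm_of_nonneg Real.pi_pos.le, mul_one]

/-- Split at the R with R^(α-1) = ε: below it r^α ≤ R^α, above it r^α = r^(α-1) r ≤ ε r. -/
theorem rpow_le_add_mul {ε : ℝ} (hα0 : 0 < α) (hα1 : α < 1) (hε : 0 < ε) :
    ∃ K : ℝ, ∀ r : ℝ, 0 < r → r ^ α ≤ K + ε * r := by
  set R : ℝ := ε ^ (1 / (α - 1)) with hR
  have hRpos : 0 < R := Real.rpow_pos_of_pos hε _
  have hRα : R ^ (α - 1) = ε := by
    rw [hR, ← Real.rpow_mul hε.le, one_div_mul_cancel (by linarith), Real.rpow_one]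
  refine ⟨R ^ α, fun r hr => ?_⟩
  rcases le_total r R with h | h
  · have := Real.rpow_le_rpow hr.le h hα0.le
    nlinarith
  · have h1 : r ^ (α - 1) ≤ ε := by
      rw [← hRα]
      exact Real.rpow_le_rpow_of_nonpos hRpos h (by linarith)
    have h2 : r ^ α = r ^ (α - 1) * r := by
      rw [Real.rpow_sub_one hr.ne', div_mul_cancel₀ _ hr.ne']
    have : 0 ≤ R ^ α := by positivity
    rw [h2]
    nlinarith

/-- For α < 1 linear decay beats r^α, whatever the sign of u. Negative u is what allows times below
0. -/
theorem integrableOn_exp_mul_exp_rpow (hα0 : 0 < α) (hα1 : α < 1) {b : ℝ} (hb : 0 < b) (u : ℝ) :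
    IntegrableOn (fun r : ℝ => Real.exp (-b * r) * Real.exp (-u * r ^ α)) (Ioi 0) := by
  obtain ⟨K, hK⟩ := rpow_le_add_mul hα0 hα1 (ε := b / (2 * (|u| + 1))) (by positivity)
  have h1 : IntegrableOn (fun r : ℝ => Real.exp (|u| * K) * Real.exp (-(b / 2) * r)) (Ioi 0) :=
    (integrableOn_exp_mul_Ioi (by linarith) 0).const_mul _
  have hm : Measurable fun r : ℝ => Real.exp (-b * r) * Real.exp (-u * r ^ α) := by fun_prop
  refine h1.mono' hm.aestronglyMeasurable ?_
  filter_upwards [ae_restrict_mem measurableSet_Ioi] with r hr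
  have hr : 0 < r := hr
  rw [Real.norm_of_nonneg (by positivity), ← Real.exp_add, ← Real.exp_add, Real.exp_le_exp]
  have h2 : -u * r ^ α ≤ |u| * r ^ α :=
    mul_le_mul_of_nonneg_right (neg_le_abs u) (by positivity)
  have h3 := mul_le_mul_of_nonneg_left (hK r hr) (abs_nonneg u)
  have h4 : |u| * (b / (2 * (|u| + 1)) * r) ≤ b / 2 * r := by
    have : |u| * (b / (2 * (|u| + 1)) * r) = |u| / (|u| + 1) * (b / 2 * r) := by
      field_simp
    rw [this]
    refine mul_le_of_le_one_left (by positivity) ?_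
    rw [div_le_one (by positivity)]
    linarith
  nlinarith

theorem measurable_rayPoint_cpow (θ a : ℝ) : Measurable fun r => rayPoint θ r ^ (a : ℂ) :=
  (continuous_rayPoint θ).measurable.pow_const _

/-- The weight in front of `exp (-t s ^ α)` in `stableDensity`. -/
noncomputable def timeWeight (θ x r : ℝ) : ℂ := rayFactor θ * Complex.exp (x * rayPoint θ r)

/-- The weight in front of `exp (x s)` in `stableDensity`. -/
noncomputable def spaceWeight (α θ t r : ℝ) : ℂ :=
  rayFactor θ * Complex.exp (-t * rayPoint θ r ^ (α : ℂ))

theorem stableDensity_eq_space (α θ x t : ℝ) : stableDensity α θ x t =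
    (∫ r in Ioi (0 : ℝ), spaceWeight α θ t r * Complex.exp (-x * -rayPoint θ r)).re := by
  rw [stableDensity]
  congr 2
  funext r
  rw [spaceWeight, neg_mul_neg]
  ring

theorem norm_timeWeight (θ x r : ℝ) :
    ‖timeWeight θ x r‖ = 1 / Real.pi * Real.exp (-(x * -Real.cos θ) * r) := by
  rw [timeWeight, norm_mul, norm_rayFactor, Complex.norm_exp, Complex.re_ofReal_mul, re_rayPoint]
  ring_nf

theorem aestronglyMeasurable_timeWeight (θ x : ℝ) :
    AEStronglyMeasurable (timeWeight θ x) (volume.restrict (Ioi 0)) := by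
  have := continuous_rayPoint θ
  unfold timeWeight
  exact Continuous.aestronglyMeasurable (by fun_prop)

theorem aestronglyMeasurable_spaceWeight (α θ t : ℝ) :
    AEStronglyMeasurable (spaceWeight α θ t) (volume.restrict (Ioi 0)) := by
  have := measurable_rayPoint_cpow θ α
  unfold spaceWeight
  exact Measurable.aestronglyMeasurable (by fun_prop)

/-- The angles of the rays on which both `exp (x s)` and `exp (-t s ^ α)` decay. -/
structure IsDecayAngle (α θ : ℝ) : Prop where
  pi_div_two_lt : Real.pi / 2 < θ
  lt_pi : θ < Real.pi
  mul_lt : α * θ < Real.pi / 2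

/-- Since α < 1, there is room between π/2 and min(π, π/(2α)). -/
theorem exists_isDecayAngle (hα0 : 0 < α) (hα1 : α < 1) : ∃ θ, IsDecayAngle α θ := by
  have hpi := Real.pi_pos
  have h : Real.pi / 2 < min Real.pi (Real.pi / 2 / α) := by
    refine lt_min (by linarith) ?_
    rw [lt_div_iff₀ hα0]
    nlinarith
  obtain ⟨θ, h1, h2⟩ := exists_between h
  refine ⟨θ, h1, h2.trans_le (min_le_left _ _), ?_⟩
  have := h2.trans_le (min_le_right _ _)
  rw [lt_div_iff₀ hα0] at this
  linarith

theorem IsDecayAngle.neg_pi_lt (h : IsDecayAngle α θ) : -Real.pi < θ := by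
  linarith [h.pi_div_two_lt, Real.pi_pos]

theorem IsDecayAngle.neg_cos_pos (h : IsDecayAngle α θ) : 0 < -Real.cos θ :=
  neg_pos.2 (Real.cos_neg_of_pi_div_two_lt_of_lt h.pi_div_two_lt
    (by linarith [h.lt_pi, Real.pi_pos]))

theorem IsDecayAngle.cos_mul_pos (h : IsDecayAngle α θ) (hα0 : 0 < α) : 0 < Real.cos (α * θ) := by
  refine Real.cos_pos_of_mem_Ioo ⟨?_, h.mul_lt⟩
  have : 0 < α * θ := mul_pos hα0 (by linarith [h.pi_div_two_lt, Real.pi_pos])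
  linarith [Real.pi_pos]

theorem IsDecayAngle.re_cpow (h : IsDecayAngle α θ) :
    ∀ᵐ r ∂(volume.restrict (Ioi (0 : ℝ))),
      (rayPoint θ r ^ (α : ℂ)).re = Real.cos (α * θ) * r ^ α := by
  filter_upwards [ae_restrict_mem measurableSet_Ioi] with r hr
  exact re_rayPoint_cpow h.neg_pi_lt h.lt_pi.le α hr

theorem IsDecayAngle.sector_time (h : IsDecayAngle α θ) :
    ∀ᵐ r ∂(volume.restrict (Ioi (0 : ℝ))),
      Real.cos (α * θ) * ‖rayPoint θ r ^ (α : ℂ)‖ ≤ (rayPoint θ r ^ (α : ℂ)).re := by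
  filter_upwards [ae_restrict_mem measurableSet_Ioi, h.re_cpow] with r hr h1
  rw [h1, norm_rayPoint_cpow θ α (le_of_lt hr)]

theorem sector_space (θ : ℝ) : ∀ᵐ r ∂(volume.restrict (Ioi (0 : ℝ))),
      -Real.cos θ * ‖-rayPoint θ r‖ ≤ (-rayPoint θ r).re := by
  filter_upwards [ae_restrict_mem measurableSet_Ioi] with r hr
  rw [norm_neg, norm_rayPoint θ (le_of_lt hr), Complex.neg_re, re_rayPoint]
  exact le_of_eq (by ring)

theorem IsDecayAngle.integrable_time (h : IsDecayAngle α θ) (hα0 : 0 < α) (hα1 : α < 1)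
    {x : ℝ} (hx : 0 < x) (t : ℝ) :
    Integrable (fun r => ‖timeWeight θ x r‖ * Real.exp (-t * (rayPoint θ r ^ (α : ℂ)).re))
      (volume.restrict (Ioi 0)) := by
  refine ((integrableOn_exp_mul_exp_rpow hα0 hα1 (mul_pos hx h.neg_cos_pos)
    (t * Real.cos (α * θ))).const_mul (1 / Real.pi)).congr ?_
  filter_upwards [h.re_cpow] with r h1
  rw [h1, norm_timeWeight]
  ring_nf

theorem IsDecayAngle.norm_spaceWeight (h : IsDecayAngle α θ) (t : ℝ) :
    ∀ᵐ r ∂(volume.restrict (Ioi (0 : ℝ))),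
      ‖spaceWeight α θ t r‖ = 1 / Real.pi * Real.exp (-(t * Real.cos (α * θ)) * r ^ α) := by
  filter_upwards [h.re_cpow] with r h1
  rw [spaceWeight, norm_mul, norm_rayFactor, norm_cexp_neg_ofReal_mul, h1]
  ring_nf

theorem IsDecayAngle.integrable_space (h : IsDecayAngle α θ) (hα0 : 0 < α) (hα1 : α < 1)
    {x : ℝ} (hx : 0 < x) (t : ℝ) :
    Integrable (fun r => ‖spaceWeight α θ t r‖ * Real.exp (-x * (-rayPoint θ r).re))
      (volume.restrict (Ioi 0)) := by
  refine ((integrableOn_exp_mul_exp_rpow hα0 hα1 (mul_pos hx h.neg_cos_pos)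
    (t * Real.cos (α * θ))).const_mul (1 / Real.pi)).congr ?_
  filter_upwards [h.norm_spaceWeight t] with r h1
  rw [h1, Complex.neg_re, re_rayPoint]
  ring_nf

theorem IsDecayAngle.integrable_spaceWeight (h : IsDecayAngle α θ) (hα0 : 0 < α)
    {t : ℝ} (ht : 0 < t) : Integrable (spaceWeight α θ t) (volume.restrict (Ioi 0)) := by
  rw [← integrable_norm_iff (aestronglyMeasurable_spaceWeight α θ t)]
  have h1 := integrableOn_rpow_mul_exp_neg_mul_rpow_of_pos hα0 (q := 0) (by norm_num)
    (mul_pos ht (h.cos_mul_pos hα0))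
  refine (h1.const_mul (1 / Real.pi)).congr ?_
  filter_upwards [h.norm_spaceWeight t] with r h1
  rw [h1, Real.rpow_zero, one_mul]

theorem IsDecayAngle.contDiff_time (h : IsDecayAngle α θ) (hα0 : 0 < α) (hα1 : α < 1)
    {x : ℝ} (hx : 0 < x) : ContDiffOn ℝ (⊤ : ℕ∞) (fun s => stableDensity α θ x s) (Ioi (-1)) :=
  contDiffOn_re_integral (h.cos_mul_pos hα0) (measurable_rayPoint_cpow θ α)
    (aestronglyMeasurable_timeWeight θ x) h.sector_time
    (fun t _ => h.integrable_time hα0 hα1 hx t)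

/-- Differentiation in x brings down s. The result is written with the time weight, to coincide
literally with the Weyl derivative in t. -/
theorem IsDecayAngle.hasDerivAt_space (h : IsDecayAngle α θ) (hα0 : 0 < α) (hα1 : α < 1)
    {x : ℝ} (hx : 0 < x) (t : ℝ) :
    HasDerivAt (fun y => stableDensity α θ y t)
      (∫ r in Ioi (0 : ℝ), timeWeight θ x r * rayPoint θ r *
        Complex.exp (-t * rayPoint θ r ^ (α : ℂ))).re x := by
  have h1 := hasDerivAt_re_integral_succ (m := volume.restrict (Ioi 0)) h.neg_cos_pos
    (continuous_rayPoint θ).neg.measurable (aestronglyMeasurable_spaceWeight α θ t)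
    (sector_space θ) (fun x hx => h.integrable_space hα0 hα1 hx t) 0 hx
  simp only [pow_zero, mul_one, zero_add, pow_one, Pi.neg_apply, neg_neg, neg_mul_neg] at h1
  simp only [stableDensity_eq_space, neg_mul_neg]
  convert! h1 using 3
  funext r
  simp only [timeWeight, spaceWeight]
  ring

theorem IsDecayAngle.hasRLDeriv (h : IsDecayAngle α θ) (hα0 : 0 < α) (hα1 : α < 1)
    {x : ℝ} (hx : 0 < x) {t : ℝ} (ht : 0 < t) :
    HasRLDeriv (1 / α) (fun s => stableDensity α θ x s) t
      (∫ r in Ioi (0 : ℝ), timeWeight θ x r * rayPoint θ r *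
        Complex.exp (-t * rayPoint θ r ^ (α : ℂ))).re := by
  have hβ0 : 0 < ((⌊1 / α⌋₊ + 1 : ℕ) : ℝ) - 1 / α := by
    have := Nat.lt_floor_add_one (1 / α); push_cast; linarith
  have hβ1 : ((⌊1 / α⌋₊ + 1 : ℕ) : ℝ) - 1 / α ≤ 1 := by
    have := Nat.floor_le (by positivity : 0 ≤ 1 / α); push_cast; linarith
  have h1 := hasRLDeriv_re_integral (m := volume.restrict (Ioi 0)) (ν := 1 / α)
    (h.cos_mul_pos hα0) (measurable_rayPoint_cpow θ α) (aestronglyMeasurable_timeWeight θ x)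
    h.sector_time ?_ (fun t ht => ?_) (f := fun s => stableDensity α θ x s) (fun s _ => rfl) ht
  · simpa only [cpow_cpow_inv hα0 hα1.le] using h1
  · filter_upwards [ae_restrict_mem measurableSet_Ioi] with r hr
    simp [Complex.cpow_eq_zero_iff, rayPoint_ne_zero θ hr]
  · set β := ((⌊1 / α⌋₊ + 1 : ℕ) : ℝ) - 1 / α
    -- From β ≤ 1 and α < 1 follows -αβ > -1, so the singularity of |s^α|^(-β) at r = 0 is
    -- integrable.
    have h2 := integrableOn_rpow_mul_exp_neg_mul_rpow_of_pos hα0 (q := α * -β) (by nlinarith)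
      (mul_pos ht (h.cos_mul_pos hα0))
    have hm : Measurable fun r => ‖rayPoint θ r ^ (α : ℂ)‖ ^ (-β) *
        Real.exp (-t * (rayPoint θ r ^ (α : ℂ)).re) := by
      have := measurable_rayPoint_cpow θ α
      have h3 := Complex.measurable_re.comp this
      simp only [Function.comp_def] at h3
      fun_prop
    refine (h2.const_mul (1 / Real.pi)).mono' ?_ ?_
    · simp only [mul_assoc]
      exact (aestronglyMeasurable_timeWeight θ x).norm.mul hm.aestronglyMeasurable
    · filter_upwards [ae_restrict_mem measurableSet_Ioi, h.re_cpow] with r hr h3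
      have hr : 0 < r := hr
      rw [Real.norm_of_nonneg (by positivity), h3, norm_timeWeight, norm_rayPoint_cpow θ α hr.le,
        ← Real.rpow_mul hr.le]
      have h4 : Real.exp (-(x * -Real.cos θ) * r) ≤ 1 := by
        rw [Real.exp_le_one_iff]
        have := mul_pos (mul_pos hx h.neg_cos_pos) hr
        linarith
      calc 1 / Real.pi * Real.exp (-(x * -Real.cos θ) * r) * r ^ (α * -β) *
            Real.exp (-t * (Real.cos (α * θ) * r ^ α))
          ≤ 1 / Real.pi * 1 * r ^ (α * -β) * Real.exp (-t * (Real.cos (α * θ) * r ^ α)) := by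
            gcongr
        _ = _ := by ring_nf

/-- At t = 0 only (-1)^j s^(αj) exp(x s) remains: an Euler integral with rate -x e^(iθ), of positive
real part. -/
theorem IsDecayAngle.iteratedDeriv_zero (h : IsDecayAngle α θ) (hα0 : 0 < α) (hα1 : α < 1)
    {x : ℝ} (hx : 0 < x) {j : ℕ} (hj : 1 ≤ j) (hjα : α * j < 1) :
    iteratedDeriv j (fun s => stableDensity α θ x s) 0 =
      (-1) ^ j * (x ^ (-α * j - 1) / Real.Gamma (-α * j)) := by
  have h1 := iteratedDeriv_re_integral (a := -1) (x := 0) (h.cos_mul_pos hα0)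
    (measurable_rayPoint_cpow θ α)
    (aestronglyMeasurable_timeWeight θ x) h.sector_time
    (fun t _ => h.integrable_time hα0 hα1 hx t) j (by norm_num)
  set a : ℝ := α * j with ha
  have ha0 : 0 < a := mul_pos hα0 (by exact_mod_cast hj)
  have hpi := Real.pi_pos
  have hcos : 0 < (-(x * Complex.exp (θ * Complex.I))).re := by
    rw [Complex.neg_re, Complex.re_ofReal_mul, Complex.exp_ofReal_mul_I_re]
    nlinarith [mul_pos hx h.neg_cos_pos]
  have hpow : (-(x * Complex.exp (θ * Complex.I))) ^ (-(a + 1 : ℝ) : ℂ) =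
      (x ^ (-(a + 1)) : ℝ) * Complex.exp ((-(a + 1) * (θ - Real.pi) : ℝ) * Complex.I) := by
    have h2 : -(x * Complex.exp (θ * Complex.I)) = rayPoint (θ - Real.pi) x := by
      rw [rayPoint, Complex.ofReal_sub, sub_mul, Complex.exp_sub, Complex.exp_pi_mul_I]
      ring
    rw [h2, ← Complex.ofReal_neg, rayPoint_cpow (by linarith [h.pi_div_two_lt])
      (by linarith [h.lt_pi]) _ hx]
  have hint : ∫ r in Ioi (0 : ℝ), timeWeight θ x r * (-rayPoint θ r ^ (α : ℂ)) ^ j *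
      Complex.exp (-(0 : ℝ) * rayPoint θ r ^ (α : ℂ)) =
      (-1) ^ j * rayFactor θ * Complex.exp ((a * θ : ℝ) * Complex.I) *
        (Real.Gamma (a + 1) * (-(x * Complex.exp (θ * Complex.I))) ^ (-(a + 1 : ℝ) : ℂ)) := by
    rw [← integral_rpow_mul_cexp_neg_mul_Ioi (by linarith) hcos, ← integral_const_mul]
    refine setIntegral_congr_fun measurableSet_Ioi fun r hr => ?_
    have h3 : (rayPoint θ r ^ (α : ℂ)) ^ j =
        (r ^ a : ℝ) * Complex.exp ((a * θ : ℝ) * Complex.I) := by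
      rw [← rayPoint_cpow h.neg_pi_lt h.lt_pi.le a hr, ha, Complex.ofReal_mul, mul_comm (α : ℂ),
        Complex.ofReal_natCast, Complex.cpow_nat_mul]
    rw [neg_pow, h3, timeWeight, add_sub_cancel_right, Complex.ofReal_zero, neg_zero, zero_mul,
      Complex.exp_zero, neg_neg, rayPoint]
    ring_nf
  -- The phases θ, aθ and -(a + 1)(θ - π) add up to (a + 1)π, so the value does not depend on the
  -- ray.
  have hexp : Complex.exp (θ * Complex.I) * Complex.exp ((a * θ : ℝ) * Complex.I) *
      Complex.exp ((-(a + 1) * (θ - Real.pi) : ℝ) * Complex.I) =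
      Complex.exp (((a + 1) * Real.pi : ℝ) * Complex.I) := by
    rw [← Complex.exp_add, ← Complex.exp_add]
    congr 1
    push_cast
    ring
  -- Reflection at -a; as 0 < a < 1 the sine does not vanish.
  have hrefl : Real.Gamma (a + 1) * (Real.sin ((a + 1) * Real.pi) / Real.pi) =
      1 / Real.Gamma (-a) := by
    have h4 := Real.Gamma_mul_Gamma_one_sub (-a)
    have h5 : 0 < Real.sin (Real.pi * a) :=
      Real.sin_pos_of_pos_of_lt_pi (by positivity) (by nlinarith)
    have h6 : Real.sin ((a + 1) * Real.pi) = -Real.sin (Real.pi * a) := by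
      rw [add_mul, one_mul, Real.sin_add_pi, mul_comm]
    rw [mul_neg, Real.sin_neg, sub_neg_eq_add, add_comm 1 a] at h4
    have h7 : Real.Gamma (-a) ≠ 0 := by
      intro h0
      rw [h0, zero_mul] at h4
      have : Real.pi / -Real.sin (Real.pi * a) ≠ 0 :=
        div_ne_zero hpi.ne' (neg_ne_zero.2 h5.ne')
      exact this h4.symm
    rw [h6, eq_div_iff h7]
    have h8 : Real.Gamma (a + 1) * Real.Gamma (-a) = Real.pi / -Real.sin (Real.pi * a) := by
      rw [mul_comm, h4]
    calc _ = Real.Gamma (a + 1) * Real.Gamma (-a) * (-Real.sin (Real.pi * a) / Real.pi) := by ring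
      _ = 1 := by
        rw [h8]
        have := h5.ne'
        field_simp
  have hval : (-1) ^ j * rayFactor θ * Complex.exp ((a * θ : ℝ) * Complex.I) *
        (Real.Gamma (a + 1) * (-(x * Complex.exp (θ * Complex.I))) ^ (-(a + 1 : ℝ) : ℂ)) =
      (((-1) ^ j * Real.Gamma (a + 1) * x ^ (-(a + 1)) / Real.pi : ℝ) : ℂ) *
        (-Complex.I * Complex.exp (((a + 1) * Real.pi : ℝ) * Complex.I)) := by
    rw [hpow, ← hexp, rayFactor]
    push_cast
    ring
  have hre : (-Complex.I * Complex.exp (((a + 1) * Real.pi : ℝ) * Complex.I)).re =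
      Real.sin ((a + 1) * Real.pi) := by
    rw [neg_mul, Complex.neg_re, Complex.I_mul_re, neg_neg, Complex.exp_ofReal_mul_I_im]
  refine h1.trans ?_
  rw [hint, hval, Complex.re_ofReal_mul, hre, neg_mul, ← ha,
    show -a - 1 = -(a + 1) by ring, div_eq_mul_one_div (x ^ _), ← hrefl]
  ring

/-- Substituting v = r^α gives a Gamma integral of phase e^(-iθ), which cancels e^(iθ) in the ray
factor and leaves a real multiple of -i. This is the boundary value at x = 0. -/
theorem IsDecayAngle.integral_spaceWeight (h : IsDecayAngle α θ) (hα0 : 0 < α)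
    {t : ℝ} (ht : 0 < t) : (∫ r in Ioi (0 : ℝ), spaceWeight α θ t r).re = 0 := by
  set w : ℂ := Complex.exp ((α * θ : ℝ) * Complex.I) with hw
  have hwre : 0 < (t * w).re := by
    rw [Complex.re_ofReal_mul, hw, Complex.exp_ofReal_mul_I_re]
    exact mul_pos ht (h.cos_mul_pos hα0)
  have h1 : ∫ r in Ioi (0 : ℝ), spaceWeight α θ t r =
      rayFactor θ * ∫ r in Ioi (0 : ℝ), Complex.exp (-(t * w) * (r ^ α : ℝ)) := by
    rw [← integral_const_mul]
    refine setIntegral_congr_fun measurableSet_Ioi fun r hr => ?_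
    simp only [spaceWeight]
    rw [rayPoint_cpow h.neg_pi_lt h.lt_pi.le α hr, ← hw]
    ring_nf
  have h2 : ∫ r in Ioi (0 : ℝ), Complex.exp (-(t * w) * (r ^ α : ℝ)) =
      (1 / α : ℝ) * (Real.Gamma (1 / α) * (t * w) ^ (-(1 / α : ℝ) : ℂ)) := by
    rw [← integral_rpow_mul_cexp_neg_mul_Ioi (one_div_pos.2 hα0) hwre, ← integral_const_mul,
      ← integral_comp_rpow_Ioi_of_pos (one_div_pos.2 hα0)]
    refine setIntegral_congr_fun measurableSet_Ioi fun v hv => ?_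
    have hv : 0 < v := hv
    rw [← Real.rpow_mul hv.le, one_div_mul_cancel hα0.ne', Real.rpow_one, Complex.real_smul]
    push_cast
    ring
  have h3 : (t * w) ^ (-(1 / α : ℝ) : ℂ) =
      (t ^ (-(1 / α)) : ℝ) * Complex.exp ((-θ : ℝ) * Complex.I) := by
    have h4 : (t : ℂ) * w = rayPoint (α * θ) t := by rw [rayPoint, hw]
    have h5 : 0 < α * θ := mul_pos hα0 (by linarith [h.pi_div_two_lt, Real.pi_pos])
    rw [h4, ← Complex.ofReal_neg, rayPoint_cpow (by linarith [Real.pi_pos])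
      (by linarith [h.mul_lt, Real.pi_pos]) _ ht]
    congr 3
    field_simp
  have h6 : Complex.exp (θ * Complex.I) * Complex.exp ((-θ : ℝ) * Complex.I) = 1 := by
    rw [← Complex.exp_add]; simp
  have h7 : ∫ r in Ioi (0 : ℝ), spaceWeight α θ t r =
      ((1 / Real.pi * (1 / α) * Real.Gamma (1 / α) * t ^ (-(1 / α)) : ℝ) : ℂ) * -Complex.I := by
    rw [h1, h2, h3, rayFactor]
    push_cast
    push_cast at h6
    linear_combination (-Complex.I / Real.pi * (1 / α) * Real.Gamma (1 / α) *
      ((t ^ (-(1 / α)) : ℝ) : ℂ)) * h6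
  rw [h7, Complex.re_ofReal_mul]
  simp

theorem IsDecayAngle.abs_stableDensity_le (h : IsDecayAngle α θ) (hα0 : 0 < α)
    {t : ℝ} (ht : 0 < t) : ∃ C, ∀ x, 0 < x → |stableDensity α θ x t| ≤ C := by
  refine ⟨∫ r in Ioi (0 : ℝ), ‖spaceWeight α θ t r‖, fun x hx => ?_⟩
  rw [stableDensity_eq_space]
  refine (Complex.abs_re_le_norm _).trans ((norm_integral_le_integral_norm _).trans ?_)
  have hle : ∀ r ∈ Ioi (0 : ℝ), ‖spaceWeight α θ t r * Complex.exp (-x * -rayPoint θ r)‖ ≤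
      ‖spaceWeight α θ t r‖ := by
    intro r hr
    rw [norm_mul, norm_cexp_neg_ofReal_mul, Complex.neg_re, re_rayPoint]
    refine mul_le_of_le_one_right (norm_nonneg _) (Real.exp_le_one_iff.2 ?_)
    nlinarith [mul_pos (mul_pos hx h.neg_cos_pos) hr]
  refine integral_mono_of_nonneg (Eventually.of_forall fun r => norm_nonneg _)
    (h.integrable_spaceWeight hα0 ht).norm ?_
  filter_upwards [ae_restrict_mem measurableSet_Ioi] with r hr using hle r hr

theorem IsDecayAngle.tendsto_space_zero (h : IsDecayAngle α θ) (hα0 : 0 < α)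
    {t : ℝ} (ht : 0 < t) : Tendsto (fun x => stableDensity α θ x t) (𝓝[>] 0) (𝓝 0) := by
  have h1 : Tendsto (fun x : ℝ => ∫ r in Ioi (0 : ℝ),
      spaceWeight α θ t r * Complex.exp (-x * -rayPoint θ r)) (𝓝[>] 0)
      (𝓝 (∫ r in Ioi (0 : ℝ), spaceWeight α θ t r)) := by
    refine tendsto_integral_filter_of_dominated_convergence (fun r => ‖spaceWeight α θ t r‖)
      (Eventually.of_forall fun x => aestronglyMeasurable_mul_cexp
        (continuous_rayPoint θ).neg.measurable (aestronglyMeasurable_spaceWeight α θ t) x)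
      ?_ (h.integrable_spaceWeight hα0 ht).norm (Eventually.of_forall fun r => ?_)
    · filter_upwards [self_mem_nhdsWithin] with x hx
      filter_upwards [ae_restrict_mem measurableSet_Ioi] with r hr
      rw [norm_mul, norm_cexp_neg_ofReal_mul, Complex.neg_re, re_rayPoint]
      refine mul_le_of_le_one_right (norm_nonneg _) (Real.exp_le_one_iff.2 ?_)
      nlinarith [mul_pos (mul_pos hx h.neg_cos_pos) hr]
    · have : Continuous fun x : ℝ =>
          spaceWeight α θ t r * Complex.exp (-x * -rayPoint θ r) := by fun_prop
      exact (this.tendsto' 0 _ (by simp)).mono_left nhdsWithin_le_nhds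
  have h2 := (Complex.continuous_re.tendsto _).comp h1
  rw [h.integral_spaceWeight hα0 ht] at h2
  simpa only [stableDensity_eq_space] using! h2

end StableDensity

/-! ### Rotation of a ray to the positive axis. -/

section RayRotation

variable {θ : ℝ}

theorem cexp_mem_slitPlane {w : ℂ} (h1 : -Real.pi < w.im) (h2 : w.im < Real.pi) :
    Complex.exp w ∈ Complex.slitPlane := by
  rw [Complex.mem_slitPlane_iff_arg, ← Complex.log_im, Complex.log_exp h1 h2.le]
  exact ⟨h2.ne, Complex.exp_ne_zero w⟩

theorem cexp_add_mul_I_eq_rayPoint (u φ : ℝ) :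
    Complex.exp (u + φ * Complex.I) = rayPoint φ (Real.exp u) := by
  rw [rayPoint, Complex.exp_add, Complex.ofReal_exp]

theorem tendsto_integral_log_ray {G : ℝ → ℂ} (hG : IntegrableOn G (Ioi 0)) :
    Tendsto (fun R : ℝ => ∫ u in (-R)..R, Real.exp u • G (Real.exp u)) atTop
      (𝓝 (∫ r in Ioi (0 : ℝ), G r)) := by
  have himg : Real.exp '' univ = Ioi 0 := by rw [image_univ, Real.range_exp]
  have hd : ∀ u ∈ (univ : Set ℝ), HasDerivWithinAt Real.exp (Real.exp u) univ u :=
    fun u _ => (Real.hasDerivAt_exp u).hasDerivWithinAt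
  have hi := (integrableOn_image_iff_integrableOn_abs_deriv_smul MeasurableSet.univ hd
    Real.exp_injective.injOn G).1 (by rwa [himg])
  have he := integral_image_eq_integral_abs_deriv_smul MeasurableSet.univ hd
    Real.exp_injective.injOn G
  simp only [himg, Measure.restrict_univ, Real.abs_exp] at he
  simp only [integrableOn_univ, Real.abs_exp] at hi
  rw [he]
  exact intervalIntegral_tendsto_integral hi tendsto_neg_atTop_atBot tendsto_id

/-- A function holomorphic in the slit plane and real on the positive axis has a real integral
along every ray, provided that it is small at `0` and at `∞`. -/
theorem im_integral_ray_eq_zero (hθ0 : 0 < θ) (hθ1 : θ < Real.pi) {F : ℂ → ℂ}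
    (hF : DifferentiableOn ℂ F Complex.slitPlane) (hreal : ∀ r : ℝ, 0 < r → (F r).im = 0)
    (hint : IntegrableOn (fun r => Complex.exp (θ * Complex.I) * F (rayPoint θ r)) (Ioi 0))
    {g₀ g₁ : ℝ → ℝ} (hg₀ : Tendsto (fun r => r * g₀ r) (𝓝[>] 0) (𝓝 0))
    (hg₁ : Tendsto (fun r => r * g₁ r) atTop (𝓝 0))
    (hF₀ : ∀ᶠ r in 𝓝[>] 0, ∀ φ ∈ Icc 0 θ, ‖F (rayPoint φ r)‖ ≤ g₀ r)
    (hF₁ : ∀ᶠ r in atTop, ∀ φ ∈ Icc 0 θ, ‖F (rayPoint φ r)‖ ≤ g₁ r) :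
    (∫ r in Ioi (0 : ℝ), Complex.exp (θ * Complex.I) * F (rayPoint θ r)).im = 0 := by
  -- In the coordinate s = e^w rays become horizontal lines and arcs vertical segments, so Cauchy's
  -- theorem is needed only on rectangles.
  set f : ℂ → ℂ := fun w => Complex.exp w * F (Complex.exp w) with hf
  have hfd : DifferentiableOn ℂ f {w | -Real.pi < w.im ∧ w.im < Real.pi} := by
    refine Complex.differentiable_exp.differentiableOn.mul (hF.comp
      Complex.differentiable_exp.differentiableOn fun w hw => cexp_mem_slitPlane hw.1 hw.2)
  -- A vertical side is an arc of radius r = exp(v R) and angle θ, so its integral is at most θ r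
  -- g(r).
  have hside : ∀ (g : ℝ → ℝ) (l : Filter ℝ) (v : ℝ → ℝ),
      Tendsto (fun r => r * g r) l (𝓝 0) → (∀ᶠ r in l, ∀ φ ∈ Icc 0 θ, ‖F (rayPoint φ r)‖ ≤ g r) →
      Tendsto (fun R => Real.exp (v R)) atTop l →
      Tendsto (fun R => Complex.I * ∫ y in (0 : ℝ)..θ, f (v R + y * Complex.I)) atTop (𝓝 0) := by
    intro g l v hg hFg hv
    have h1 : Tendsto (fun R => (Real.exp (v R) * g (Real.exp (v R))) * θ) atTop (𝓝 0) := by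
      simpa using (hg.comp hv).mul_const θ
    refine squeeze_zero_norm' ?_ h1
    filter_upwards [hv.eventually hFg] with R hR
    rw [norm_mul, Complex.norm_I, one_mul]
    have := intervalIntegral.norm_integral_le_of_norm_le_const
      (a := 0) (b := θ) (f := fun y : ℝ => f (v R + y * Complex.I))
      (C := Real.exp (v R) * g (Real.exp (v R))) ?_
    · simpa [abs_of_pos hθ0] using this
    · intro y hy
      rw [uIoc_of_le hθ0.le] at hy
      simp only [hf]
      rw [cexp_add_mul_I_eq_rayPoint, norm_mul, norm_rayPoint y (Real.exp_nonneg _)]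
      exact mul_le_mul_of_nonneg_left (hR y ⟨hy.1.le, hy.2⟩) (Real.exp_nonneg _)
  have hright := hside g₁ atTop id hg₁ hF₁ Real.tendsto_exp_atTop
  have hleft := hside g₀ (𝓝[>] 0) Neg.neg hg₀ hF₀
    (Real.tendsto_exp_atBot_nhdsGT.comp tendsto_neg_atTop_atBot)
  have htop := tendsto_integral_log_ray hint
  have hrect : ∀ R : ℝ, (∫ u in (-R)..R, Real.exp u •
      (Complex.exp (θ * Complex.I) * F (rayPoint θ (Real.exp u)))).im =
      (Complex.I * ∫ y in (0 : ℝ)..θ, f ((id R : ℝ) + y * Complex.I)).im -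
      (Complex.I * ∫ y in (0 : ℝ)..θ, f ((-R : ℝ) + y * Complex.I)).im := by
    intro R
    have h := Complex.integral_boundary_rect_eq_zero_of_differentiableOn f (-R : ℝ)
      (R + θ * Complex.I) (hfd.mono ?_)
    · simp only [Complex.ofReal_re, Complex.ofReal_im, Complex.add_re, Complex.add_im,
        Complex.re_ofReal_mul, Complex.im_ofReal_mul, Complex.I_re, Complex.I_im, mul_zero,
        mul_one, add_zero, zero_add, Complex.ofReal_zero, zero_mul, smul_eq_mul] at h
      -- The bottom side is the positive axis, where f is real; it drops out of the imaginary part.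
      have hbot : (∫ x in (-R)..R, f (x : ℂ)).im = 0 := by
        have h1 : ∀ x : ℝ, f x = ((f x).re : ℂ) := by
          intro x
          refine Complex.ext rfl ?_
          have := hreal (Real.exp x) (Real.exp_pos x)
          rw [Complex.ofReal_exp] at this
          rw [← Complex.ofReal_exp] at this
          simp only [hf, ← Complex.ofReal_exp, Complex.im_ofReal_mul, this, mul_zero,
            Complex.ofReal_im]
        rw [intervalIntegral.integral_congr (g := fun x : ℝ => ((f x).re : ℂ))
          (fun x _ => h1 x), intervalIntegral.integral_ofReal, Complex.ofReal_im]
      have heq : ∫ x in (-R)..R, f (x + θ * Complex.I) = ∫ u in (-R)..R, Real.exp u •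
          (Complex.exp (θ * Complex.I) * F (rayPoint θ (Real.exp u))) := by
        refine intervalIntegral.integral_congr fun u _ => ?_
        simp only [hf]
        rw [cexp_add_mul_I_eq_rayPoint, Complex.real_smul, ← mul_assoc]
        rfl
      rw [heq] at h
      have h2 := congrArg Complex.im h
      simp only [Complex.add_im, Complex.sub_im, Complex.zero_im] at h2
      simp only [id]
      linarith
    · intro w hw
      have hw2 := hw.2
      simp only [Complex.ofReal_im, Complex.add_im, Complex.im_ofReal_mul, Complex.I_im, mul_one,
        zero_add, mem_preimage, uIcc_of_le hθ0.le] at hw2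
      exact ⟨by linarith [hw2.1, Real.pi_pos], by linarith [hw2.2]⟩
  have hlim : Tendsto (fun R : ℝ => (∫ u in (-R)..R, Real.exp u •
      (Complex.exp (θ * Complex.I) * F (rayPoint θ (Real.exp u)))).im) atTop (𝓝 0) := by
    simp_rw [hrect]
    have h1 := ((Complex.continuous_im.tendsto _).comp hright).sub
      ((Complex.continuous_im.tendsto _).comp hleft)
    simpa using! h1
  exact tendsto_nhds_unique ((Complex.continuous_im.tendsto _).comp htop) hlim

end RayRotation

/-! ### An elementary rational integral along a ray. -/

section StableLaplace

variable {α θ : ℝ}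

theorem rayPoint_zero_right (θ : ℝ) : rayPoint θ 0 = 0 := by simp [rayPoint]

theorem hasDerivAt_rayPoint (θ r : ℝ) :
    HasDerivAt (rayPoint θ) (Complex.exp (θ * Complex.I)) r := by
  simpa [rayPoint] using! (Complex.ofRealCLM.hasDerivAt (x := r)).mul_const
    (Complex.exp (θ * Complex.I))

theorem one_add_rayPoint_mem_slitPlane (hθ0 : 0 < θ) (hθ1 : θ < Real.pi) {r : ℝ} (hr : 0 ≤ r) :
    1 + rayPoint θ r ∈ Complex.slitPlane := by
  rcases hr.eq_or_lt with rfl | hr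
  · simp [rayPoint_zero_right]
  · refine Or.inr ?_
    rw [Complex.add_im, Complex.one_im, zero_add, im_rayPoint]
    exact (mul_pos hr (Real.sin_pos_of_pos_of_lt_pi hθ0 hθ1)).ne'

theorem sub_rayPoint_mem_slitPlane (hθ0 : 0 < θ) (hθ1 : θ < Real.pi) {ξ : ℝ} (hξ : 0 < ξ)
    {r : ℝ} (hr : 0 ≤ r) : (ξ : ℂ) - rayPoint θ r ∈ Complex.slitPlane := by
  rcases hr.eq_or_lt with rfl | hr
  · simp [rayPoint_zero_right, hξ]
  · refine Or.inr ?_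
    rw [Complex.sub_im, Complex.ofReal_im, zero_sub, im_rayPoint]
    exact neg_ne_zero.2 (mul_pos hr (Real.sin_pos_of_pos_of_lt_pi hθ0 hθ1)).ne'

theorem normSq_sub_rayPoint (ξ θ r : ℝ) :
    ‖(ξ : ℂ) - rayPoint θ r‖ ^ 2 = ξ ^ 2 - 2 * ξ * r * Real.cos θ + r ^ 2 := by
  rw [← Complex.normSq_eq_norm_sq, Complex.normSq_apply, Complex.sub_re, Complex.sub_im,
    Complex.ofReal_re, Complex.ofReal_im, re_rayPoint, im_rayPoint]
  nlinarith [Real.sin_sq_add_cos_sq θ]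

theorem mul_le_normSq_sub_rayPoint (ξ θ r : ℝ) :
    (1 - |Real.cos θ|) * (ξ ^ 2 + r ^ 2) ≤ ‖(ξ : ℂ) - rayPoint θ r‖ ^ 2 := by
  rw [normSq_sub_rayPoint]
  rcases abs_cases (Real.cos θ) with ⟨h, h'⟩ | ⟨h, h'⟩ <;> rw [h]
  · nlinarith [mul_nonneg h' (sq_nonneg (ξ - r))]
  · nlinarith [mul_nonneg (neg_nonneg.2 h'.le) (sq_nonneg (ξ + r))]

theorem abs_cos_lt_one (hθ0 : 0 < θ) (hθ1 : θ < Real.pi) : |Real.cos θ| < 1 := by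
  have h1 := Real.sin_pos_of_pos_of_lt_pi hθ0 hθ1
  rw [abs_lt]
  constructor <;> nlinarith [Real.sin_sq_add_cos_sq θ]

theorem one_add_rayPoint_eq (θ r : ℝ) : 1 + rayPoint θ r = -(((-1 : ℝ) : ℂ) - rayPoint θ r) := by
  push_cast; ring

/-- The two fractions add up to (1 + ξ)/((1 + s)(ξ - s)), which decays like r^(-2); separately they
decay only like 1/r. -/
theorem integrableOn_ray_rational (hθ0 : 0 < θ) (hθ1 : θ < Real.pi) {ξ : ℝ} (hξ : 0 < ξ) :
    IntegrableOn (fun r => Complex.exp (θ * Complex.I) *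
      (1 / (1 + rayPoint θ r) + 1 / (ξ - rayPoint θ r))) (Ioi 0) := by
  set k : ℝ := 1 - |Real.cos θ| with hk
  have hkpos : 0 < k := by linarith [abs_cos_lt_one hθ0 hθ1]
  set d : ℝ := min 1 ξ with hd
  have hdpos : 0 < d := lt_min one_pos hξ
  have hm : AEStronglyMeasurable (fun r => Complex.exp (θ * Complex.I) *
      (1 / (1 + rayPoint θ r) + 1 / (ξ - rayPoint θ r))) (volume.restrict (Ioi 0)) := by
    have := (continuous_rayPoint θ).measurable
    exact Measurable.aestronglyMeasurable (by fun_prop)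
  have h1 : IntegrableOn (fun r : ℝ => (1 + ξ) / (k * d) * (1 + r ^ 2)⁻¹) (Ioi 0) :=
    (integrable_inv_one_add_sq.const_mul _).integrableOn
  refine h1.mono' hm ?_
  filter_upwards [ae_restrict_mem measurableSet_Ioi] with r hr
  have hr : 0 < r := hr
  have hA := Complex.slitPlane_ne_zero (one_add_rayPoint_mem_slitPlane hθ0 hθ1 hr.le)
  have hB := Complex.slitPlane_ne_zero (sub_rayPoint_mem_slitPlane hθ0 hθ1 hξ hr.le)
  have heq : 1 / (1 + rayPoint θ r) + 1 / (ξ - rayPoint θ r) =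
      ((1 + ξ : ℝ) : ℂ) / ((1 + rayPoint θ r) * (ξ - rayPoint θ r)) := by
    push_cast
    field_simp
    ring
  rw [heq, norm_mul, Complex.norm_exp_ofReal_mul_I, one_mul, norm_div, Complex.norm_real,
    Real.norm_of_nonneg (by positivity), norm_mul, ← div_eq_mul_inv, div_div]
  have h2 : k * (1 + r ^ 2) ≤ ‖1 + rayPoint θ r‖ ^ 2 := by
    have := mul_le_normSq_sub_rayPoint (-1) θ r
    rw [one_add_rayPoint_eq, norm_neg]
    linarith
  have h3 : k * (d ^ 2 * (1 + r ^ 2)) ≤ ‖(ξ : ℂ) - rayPoint θ r‖ ^ 2 := by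
    refine le_trans ?_ (mul_le_normSq_sub_rayPoint ξ θ r)
    have h4 : d ^ 2 ≤ ξ ^ 2 := pow_le_pow_left₀ hdpos.le (min_le_right _ _) 2
    have h5 : d ^ 2 ≤ 1 := pow_le_one₀ hdpos.le (min_le_left _ _)
    have h6 : d ^ 2 * (1 + r ^ 2) ≤ ξ ^ 2 + r ^ 2 := by nlinarith [sq_nonneg r]
    exact mul_le_mul_of_nonneg_left h6 hkpos.le
  have h7 : k * d * (1 + r ^ 2) ≤ ‖1 + rayPoint θ r‖ * ‖(ξ : ℂ) - rayPoint θ r‖ := by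
    refine le_of_sq_le_sq ?_ (by positivity)
    calc (k * d * (1 + r ^ 2)) ^ 2 = k * (1 + r ^ 2) * (k * (d ^ 2 * (1 + r ^ 2))) := by ring
      _ ≤ ‖1 + rayPoint θ r‖ ^ 2 * ‖(ξ : ℂ) - rayPoint θ r‖ ^ 2 := by gcongr
      _ = _ := by ring
  gcongr

/-- A primitive is log(1 + s) - log(ξ - s). At infinity the arguments tend to θ and θ - π, and their
difference produces the term πi. -/
theorem integral_ray_rational (hθ0 : 0 < θ) (hθ1 : θ < Real.pi) {ξ : ℝ} (hξ : 0 < ξ) :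
    ∫ r in Ioi (0 : ℝ), Complex.exp (θ * Complex.I) *
      (1 / (1 + rayPoint θ r) + 1 / (ξ - rayPoint θ r)) =
      Real.log ξ + Real.pi * Complex.I := by
  set e := Complex.exp (θ * Complex.I) with he
  have hsin := Real.sin_pos_of_pos_of_lt_pi hθ0 hθ1
  have hderiv : ∀ r ∈ Ici (0 : ℝ), HasDerivAt
      (fun r => Complex.log (1 + rayPoint θ r) - Complex.log (ξ - rayPoint θ r))
      (e * (1 / (1 + rayPoint θ r) + 1 / (ξ - rayPoint θ r))) r := by
    intro r hr
    have h1 := ((hasDerivAt_rayPoint θ r).const_add 1).clog_real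
      (one_add_rayPoint_mem_slitPlane hθ0 hθ1 hr)
    have h2 := ((hasDerivAt_rayPoint θ r).const_sub (ξ : ℂ)).clog_real
      (sub_rayPoint_mem_slitPlane hθ0 hθ1 hξ hr)
    exact (h1.sub h2).congr_deriv (by ring)
  have he0 : e ≠ 0 := Complex.exp_ne_zero _
  have hneg : -e = Complex.exp ((θ - Real.pi : ℝ) * Complex.I) := by
    rw [Complex.ofReal_sub, sub_mul, Complex.exp_sub, Complex.exp_pi_mul_I, div_neg, div_one]
  have hloge : Complex.log e = θ * Complex.I := by
    rw [he, Complex.log_exp] <;> simp <;> linarith [Real.pi_pos]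
  have hlogne : Complex.log (-e) = (θ - Real.pi : ℝ) * Complex.I := by
    rw [hneg, Complex.log_exp] <;> simp <;> linarith [Real.pi_pos]
  have hes : e ∈ Complex.slitPlane := Or.inr (by
    rw [he, Complex.exp_ofReal_mul_I_im]; exact hsin.ne')
  have hnes : -e ∈ Complex.slitPlane := Or.inr (by
    rw [Complex.neg_im, he, Complex.exp_ofReal_mul_I_im]; exact neg_ne_zero.2 hsin.ne')
  have hinv : ∀ a : ℝ, Tendsto (fun r : ℝ => ((a / r : ℝ) : ℂ)) atTop (𝓝 0) := by
    intro a
    exact (Complex.continuous_ofReal.tendsto' 0 0 (by simp)).comp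
      (tendsto_const_nhds.div_atTop tendsto_id)
  have hlim : Tendsto (fun r => Complex.log (1 + rayPoint θ r) - Complex.log (ξ - rayPoint θ r))
      atTop (𝓝 (Real.pi * Complex.I)) := by
    have h1 : Tendsto (fun r : ℝ => Complex.log (((1 / r : ℝ) : ℂ) + e)) atTop
        (𝓝 (Complex.log e)) := by
      refine (continuousAt_clog hes).tendsto.comp ?_
      simpa using (hinv 1).add_const e
    have h2 : Tendsto (fun r : ℝ => Complex.log (((ξ / r : ℝ) : ℂ) + -e)) atTop
        (𝓝 (Complex.log (-e))) := by
      refine (continuousAt_clog hnes).tendsto.comp ?_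
      simpa using (hinv ξ).add_const (-e)
    have h3 := h1.sub h2
    rw [hloge, hlogne, show (θ : ℂ) * Complex.I - (θ - Real.pi : ℝ) * Complex.I =
      Real.pi * Complex.I by push_cast; ring] at h3
    refine h3.congr' ?_
    filter_upwards [eventually_gt_atTop 0] with r hr
    have hr0 : (r : ℂ) ≠ 0 := by exact_mod_cast hr.ne'
    have h4 : 1 + rayPoint θ r = r * (((1 / r : ℝ) : ℂ) + e) := by
      rw [rayPoint]; push_cast; field_simp; rfl
    have h5 : ξ - rayPoint θ r = r * (((ξ / r : ℝ) : ℂ) + -e) := by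
      rw [rayPoint]; push_cast; field_simp; rfl
    have h6 : ((1 / r : ℝ) : ℂ) + e ≠ 0 := by
      intro h
      have := Complex.slitPlane_ne_zero (one_add_rayPoint_mem_slitPlane hθ0 hθ1 hr.le)
      rw [h4, h, mul_zero] at this
      exact this rfl
    have h7 : ((ξ / r : ℝ) : ℂ) + -e ≠ 0 := by
      intro h
      have := Complex.slitPlane_ne_zero (sub_rayPoint_mem_slitPlane hθ0 hθ1 hξ hr.le)
      rw [h5, h, mul_zero] at this
      exact this rfl
    rw [h4, h5, Complex.log_ofReal_mul hr h6, Complex.log_ofReal_mul hr h7]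
    ring
  rw [integral_Ioi_of_hasDerivAt_of_tendsto' hderiv (integrableOn_ray_rational hθ0 hθ1 hξ) hlim,
    rayPoint_zero_right, add_zero, sub_zero, Complex.log_one, ← Complex.ofReal_log hξ.le]
  ring

end StableLaplace

/-! ### The Laplace transform of the ray integral. -/

section StableLaplaceTransform

variable {α θ : ℝ}

/-- The numerator, vanishing at `ξ`, left after subtracting from `exp (-t s ^ α)` a rational
function whose integral along rays is elementary. -/
noncomputable def laplaceNumerator (α t ξ : ℝ) (s : ℂ) : ℂ :=
  Complex.exp (-t * s ^ (α : ℂ)) - (Real.exp (-t * ξ ^ α) * (1 + ξ) : ℝ) / (1 + s)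

theorem one_add_ne_zero_of_mem_slitPlane {s : ℂ} (hs : s ∈ Complex.slitPlane) : 1 + s ≠ 0 := by
  intro h
  have h1 : s = ((-1 : ℝ) : ℂ) := by
    push_cast; linear_combination h
  rw [h1, Complex.ofReal_mem_slitPlane] at hs
  linarith

theorem ofReal_mem_slitPlane_of_pos {r : ℝ} (hr : 0 < r) : (r : ℂ) ∈ Complex.slitPlane :=
  Complex.ofReal_mem_slitPlane.2 hr

theorem differentiableOn_laplaceNumerator (α t ξ : ℝ) :
    DifferentiableOn ℂ (laplaceNumerator α t ξ) Complex.slitPlane := by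
  intro s hs
  refine DifferentiableAt.differentiableWithinAt ?_
  exact (((differentiableAt_id.cpow_const hs).const_mul _).cexp).sub
    ((differentiableAt_const _).div ((differentiableAt_const _).add differentiableAt_id)
      (one_add_ne_zero_of_mem_slitPlane hs))

theorem laplaceNumerator_ofReal (α t ξ : ℝ) {r : ℝ} (hr : 0 < r) :
    laplaceNumerator α t ξ r =
      ((Real.exp (-t * r ^ α) - Real.exp (-t * ξ ^ α) * (1 + ξ) / (1 + r) : ℝ) : ℂ) := by
  rw [laplaceNumerator, ← Complex.ofReal_cpow hr.le]
  push_cast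
  rfl

theorem laplaceNumerator_self (α t : ℝ) {ξ : ℝ} (hξ : 0 < ξ) : laplaceNumerator α t ξ ξ = 0 := by
  rw [laplaceNumerator_ofReal α t ξ hξ, mul_div_assoc, div_self (by positivity), mul_one, sub_self,
    Complex.ofReal_zero]

theorem neg_dslope_laplaceNumerator (α t : ℝ) {ξ : ℝ} (hξ : 0 < ξ) {s : ℂ} (hs : s ≠ ξ) :
    -dslope (laplaceNumerator α t ξ) ξ s = laplaceNumerator α t ξ s / (ξ - s) := by
  rw [dslope_of_ne _ hs, slope_def_field, laplaceNumerator_self α t hξ, sub_zero, ← neg_sub s,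
    div_neg]

theorem differentiableOn_dslope_laplaceNumerator (α t : ℝ) {ξ : ℝ} (hξ : 0 < ξ) :
    DifferentiableOn ℂ (fun s => -dslope (laplaceNumerator α t ξ) ξ s) Complex.slitPlane :=
  ((Complex.differentiableOn_dslope (Complex.isOpen_slitPlane.mem_nhds
    (ofReal_mem_slitPlane_of_pos hξ))).2 (differentiableOn_laplaceNumerator α t ξ)).neg

/-- Off ξ this is a quotient of real numbers; at ξ it follows by continuity. -/
theorem im_dslope_laplaceNumerator (α t : ℝ) {ξ : ℝ} (hξ : 0 < ξ) {r : ℝ} (hr : 0 < r) :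
    (-dslope (laplaceNumerator α t ξ) ξ (r : ℂ)).im = 0 := by
  have hne : ∀ r : ℝ, 0 < r → r ≠ ξ → (-dslope (laplaceNumerator α t ξ) ξ (r : ℂ)).im = 0 := by
    intro r hr h
    rw [neg_dslope_laplaceNumerator α t hξ (by exact_mod_cast h), laplaceNumerator_ofReal α t ξ hr,
      ← Complex.ofReal_sub, ← Complex.ofReal_div, Complex.ofReal_im]
  rcases eq_or_ne r ξ with rfl | h
  · have hc : ContinuousAt (fun u : ℝ => (-dslope (laplaceNumerator α t r) r (u : ℂ)).im) r := by
      refine Complex.continuous_im.continuousAt.comp ?_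
      exact ContinuousAt.comp (f := fun u : ℝ => (u : ℂ))
        (g := fun s => -dslope (laplaceNumerator α t r) r s)
        ((differentiableOn_dslope_laplaceNumerator α t hξ).continuousOn.continuousAt
          (Complex.isOpen_slitPlane.mem_nhds (ofReal_mem_slitPlane_of_pos hξ)))
        Complex.continuous_ofReal.continuousAt
    refine tendsto_nhds_unique (hc.tendsto.mono_left nhdsWithin_le_nhds : Tendsto _ (𝓝[≠] r) _) ?_
    refine tendsto_const_nhds.congr' ?_
    filter_upwards [self_mem_nhdsWithin, nhdsWithin_le_nhds (Ioi_mem_nhds hξ)] with u hu hu0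
    exact (hne u hu0 hu).symm
  · exact hne r hr h

/-- The distances |1 + s| and |ξ - s| are bounded below through moduli alone, and cos(αφ) ≥ cos(αθ),
so the bound is uniform over the arc. -/
theorem norm_dslope_laplaceNumerator_le (h : IsDecayAngle α θ) (hα0 : 0 < α) {t : ℝ} (ht : 0 < t)
    {ξ : ℝ} (hξ : 0 < ξ) {r φ a b : ℝ} (hr : 0 < r) (hφ : φ ∈ Icc 0 θ) (ha : 0 < a) (hb : 0 < b)
    (hra : a ≤ |1 - r|) (hrb : b ≤ |ξ - r|) :
    ‖-dslope (laplaceNumerator α t ξ) ξ (rayPoint φ r)‖ ≤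
      (Real.exp (-(t * Real.cos (α * θ)) * r ^ α) + Real.exp (-t * ξ ^ α) * (1 + ξ) / a) / b := by
  have hn := norm_rayPoint φ hr.le
  have hb' : b ≤ ‖(ξ : ℂ) - rayPoint φ r‖ := by
    refine hrb.trans ?_
    have := abs_norm_sub_norm_le (ξ : ℂ) (rayPoint φ r)
    rwa [hn, Complex.norm_real, Real.norm_of_nonneg hξ.le] at this
  have ha' : a ≤ ‖1 + rayPoint φ r‖ := by
    refine hra.trans ?_
    have := abs_norm_sub_norm_le (1 : ℂ) (-rayPoint φ r)
    rwa [norm_neg, hn, norm_one, sub_neg_eq_add] at this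
  have hs : rayPoint φ r ≠ ξ := by
    intro h0
    rw [h0, sub_self, norm_zero] at hb'
    linarith
  have hexp : ‖Complex.exp (-t * rayPoint φ r ^ (α : ℂ))‖ ≤
      Real.exp (-(t * Real.cos (α * θ)) * r ^ α) := by
    rw [norm_cexp_neg_ofReal_mul, re_rayPoint_cpow (by linarith [hφ.1, Real.pi_pos])
      (hφ.2.trans h.lt_pi.le) α hr, Real.exp_le_exp]
    have h1 : Real.cos (α * θ) ≤ Real.cos (α * φ) :=
      Real.cos_le_cos_of_nonneg_of_le_pi (mul_nonneg hα0.le hφ.1)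
        (by linarith [h.mul_lt, Real.pi_pos]) (mul_le_mul_of_nonneg_left hφ.2 hα0.le)
    have h2 : 0 < t * r ^ α := by positivity
    nlinarith
  rw [neg_dslope_laplaceNumerator α t hξ hs, norm_div]
  have hnum : ‖laplaceNumerator α t ξ (rayPoint φ r)‖ ≤
      Real.exp (-(t * Real.cos (α * θ)) * r ^ α) + Real.exp (-t * ξ ^ α) * (1 + ξ) / a := by
    refine (norm_sub_le _ _).trans (add_le_add hexp ?_)
    rw [norm_div, Complex.norm_real, Real.norm_of_nonneg (by positivity)]
    gcongr
  gcongr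

theorem IsDecayAngle.integrable_exp_div (h : IsDecayAngle α θ) (hα0 : 0 < α)
    {t : ℝ} (ht : 0 < t) {ξ : ℝ} (hξ : 0 < ξ) :
    IntegrableOn (fun r => spaceWeight α θ t r * (1 / (ξ - rayPoint θ r))) (Ioi 0) := by
  have hm : AEStronglyMeasurable (fun r => spaceWeight α θ t r * (1 / (ξ - rayPoint θ r)))
      (volume.restrict (Ioi 0)) := by
    have := (continuous_rayPoint θ).measurable
    exact (aestronglyMeasurable_spaceWeight α θ t).mul
      (by fun_prop : Measurable fun r => 1 / (ξ - rayPoint θ r)).aestronglyMeasurable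
  refine ((h.integrable_spaceWeight hα0 ht).norm.mul_const (1 / ξ)).mono' hm ?_
  filter_upwards [ae_restrict_mem measurableSet_Ioi] with r hr
  have hr : 0 < r := hr
  rw [norm_mul, norm_div, norm_one]
  have : ξ ≤ ‖(ξ : ℂ) - rayPoint θ r‖ := by
    refine le_trans ?_ (Complex.re_le_norm _)
    rw [Complex.sub_re, Complex.ofReal_re, re_rayPoint]
    nlinarith [mul_pos hr h.neg_cos_pos]
  gcongr

theorem spaceWeight_eq (α θ t r : ℝ) : spaceWeight α θ t r =
    ((1 / Real.pi : ℝ) : ℂ) * (-Complex.I * (Complex.exp (θ * Complex.I) *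
      Complex.exp (-t * rayPoint θ r ^ (α : ℂ)))) := by
  rw [spaceWeight, rayFactor]; push_cast; ring

theorem IsDecayAngle.im_integral_dslope (h : IsDecayAngle α θ) (hα0 : 0 < α)
    {t : ℝ} (ht : 0 < t) {ξ : ℝ} (hξ : 0 < ξ)
    (hint : IntegrableOn (fun r => Complex.exp (θ * Complex.I) *
      -dslope (laplaceNumerator α t ξ) ξ (rayPoint θ r)) (Ioi 0)) :
    (∫ r in Ioi (0 : ℝ), Complex.exp (θ * Complex.I) *
      -dslope (laplaceNumerator α t ξ) ξ (rayPoint θ r)).im = 0 := by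
  set E := Real.exp (-t * ξ ^ α) * (1 + ξ) with hE
  have hκ : 0 < t * Real.cos (α * θ) := mul_pos ht (h.cos_mul_pos hα0)
  refine im_integral_ray_eq_zero (F := fun s => -dslope (laplaceNumerator α t ξ) ξ s)
    (by linarith [h.pi_div_two_lt, Real.pi_pos]) h.lt_pi
    (differentiableOn_dslope_laplaceNumerator α t hξ)
    (fun r hr => im_dslope_laplaceNumerator α t hξ hr) hint
    -- Near 0, r < 1/2 and r < ξ/2 give distances at least 1/2 and ξ/2. Near infinity, r > 1 and r >
    -- 2ξ give r - 1 and r/2.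
    (g₀ := fun _ => (1 + E / (1 / 2)) / (ξ / 2))
    (g₁ := fun r => (Real.exp (-(t * Real.cos (α * θ)) * r ^ α) + E / (r - 1)) / (r / 2))
    ?_ ?_ ?_ ?_
  · have : Continuous fun r : ℝ => r * ((1 + E / (1 / 2)) / (ξ / 2)) := by fun_prop
    exact (this.tendsto' 0 0 (by simp)).mono_left nhdsWithin_le_nhds
  · have h1 : Tendsto (fun r : ℝ => Real.exp (-(t * Real.cos (α * θ)) * r ^ α)) atTop (𝓝 0) :=
      Real.tendsto_exp_atBot.comp
        ((tendsto_rpow_atTop hα0).const_mul_atTop_of_neg (neg_lt_zero.2 hκ))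
    have h2 : Tendsto (fun r : ℝ => E / (r - 1)) atTop (𝓝 0) :=
      tendsto_const_nhds.div_atTop (tendsto_atTop_add_const_right _ (-1) tendsto_id)
    have h3 := (h1.add h2).const_mul 2
    rw [add_zero, mul_zero] at h3
    refine h3.congr' ?_
    filter_upwards [eventually_gt_atTop 0] with r hr
    field_simp
  · have h1 : ∀ᶠ r : ℝ in 𝓝[>] 0, r < min (1 / 2) (ξ / 2) :=
      nhdsWithin_le_nhds (Iio_mem_nhds (lt_min (by norm_num) (by linarith)))
    filter_upwards [h1, self_mem_nhdsWithin] with r hr hr0 φ hφ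
    have hr0 : 0 < r := hr0
    have hr1 := hr.trans_le (min_le_left _ _)
    have hr2 := hr.trans_le (min_le_right _ _)
    refine (norm_dslope_laplaceNumerator_le h hα0 ht hξ hr0 hφ (a := 1 / 2) (b := ξ / 2)
      (by norm_num) (by linarith) ?_ ?_).trans ?_
    · exact le_trans (by linarith) (le_abs_self _)
    · exact le_trans (by linarith) (le_abs_self _)
    · gcongr
      rw [Real.exp_le_one_iff]
      have : 0 < r ^ α := by positivity
      nlinarith
  · filter_upwards [eventually_gt_atTop (max 1 (2 * ξ))] with r hr φ hφ
    have hr1 := (le_max_left _ _).trans_lt hr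
    have hr2 := (le_max_right _ _).trans_lt hr
    refine norm_dslope_laplaceNumerator_le h hα0 ht hξ (by linarith) hφ (by linarith)
      (by linarith) ?_ ?_
    · exact le_trans (by linarith) (neg_le_abs _)
    · exact le_trans (by linarith) (neg_le_abs _)

/-- With E = exp(-t ξ^α), the part cancelling the pole has real ray integral and the rational part
contributes E (log ξ + πi). The prefactor -i/π selects the imaginary part, leaving E. -/
theorem IsDecayAngle.re_integral_spaceWeight_div (h : IsDecayAngle α θ) (hα0 : 0 < α)
    {t : ℝ} (ht : 0 < t) {ξ : ℝ} (hξ : 0 < ξ) :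
    (∫ r in Ioi (0 : ℝ), spaceWeight α θ t r * (1 / (ξ - rayPoint θ r))).re =
      Real.exp (-t * ξ ^ α) := by
  have hpi := Real.pi_pos
  have hθ0 : 0 < θ := by linarith [h.pi_div_two_lt]
  set e := Complex.exp (θ * Complex.I) with he
  set E := Real.exp (-t * ξ ^ α) with hE
  have hsplit : EqOn (fun r => spaceWeight α θ t r * (1 / (ξ - rayPoint θ r)))
      (fun r => ((1 / Real.pi : ℝ) : ℂ) * (-Complex.I *
        (e * -dslope (laplaceNumerator α t ξ) ξ (rayPoint θ r) +
        (E : ℂ) * (e * (1 / (1 + rayPoint θ r) + 1 / (ξ - rayPoint θ r)))))) (Ioi 0) := by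
    intro r hr
    have hr : 0 < r := hr
    have hA := Complex.slitPlane_ne_zero (one_add_rayPoint_mem_slitPlane hθ0 h.lt_pi hr.le)
    have hB := Complex.slitPlane_ne_zero (sub_rayPoint_mem_slitPlane hθ0 h.lt_pi hξ hr.le)
    have hs : rayPoint θ r ≠ ξ := fun h0 => hB (by rw [h0, sub_self])
    simp only
    rw [neg_dslope_laplaceNumerator α t hξ hs, laplaceNumerator, spaceWeight_eq, ← he, ← hE]
    push_cast
    field_simp
    ring
  have hint1 := h.integrable_exp_div hα0 ht hξ
  have hint2 := integrableOn_ray_rational hθ0 h.lt_pi hξ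
  have hval2 := integral_ray_rational hθ0 h.lt_pi hξ
  rw [← he] at hint2 hval2
  -- Integrability is inherited as a difference of the two integrable pieces.
  have hint : IntegrableOn (fun r => e *
      -dslope (laplaceNumerator α t ξ) ξ (rayPoint θ r)) (Ioi 0) := by
    have h1 := (hint1.const_mul (Real.pi * Complex.I : ℂ)).sub (hint2.const_mul (E : ℂ))
    refine IntegrableOn.congr_fun h1 (fun r hr => ?_) measurableSet_Ioi
    have h2 := hsplit hr
    simp only at h2
    have hpi' : (Real.pi : ℂ) ≠ 0 := by exact_mod_cast hpi.ne'
    simp only [Pi.sub_apply]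
    rw [h2]
    push_cast
    field_simp
    linear_combination -(e * -dslope (laplaceNumerator α t ξ) ξ (rayPoint θ r) +
        (E : ℂ) * (e * (1 / (1 + rayPoint θ r) + 1 / (ξ - rayPoint θ r)))) * Complex.I_sq
  have hsum : ∫ r in Ioi (0 : ℝ), (e * -dslope (laplaceNumerator α t ξ) ξ (rayPoint θ r) +
        (E : ℂ) * (e * (1 / (1 + rayPoint θ r) + 1 / (ξ - rayPoint θ r)))) =
      (∫ r in Ioi (0 : ℝ), e * -dslope (laplaceNumerator α t ξ) ξ (rayPoint θ r)) +
        E * (Real.log ξ + Real.pi * Complex.I) := by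
    rw [integral_add hint (hint2.const_mul _), ← hval2, ← integral_const_mul (E : ℂ)]
  rw [setIntegral_congr_fun measurableSet_Ioi hsplit, integral_const_mul, integral_const_mul, hsum,
    Complex.re_ofReal_mul, neg_mul, Complex.neg_re, Complex.I_mul_re, neg_neg, Complex.add_im,
    h.im_integral_dslope hα0 ht hξ hint, zero_add, Complex.im_ofReal_mul]
  simp
  field_simp

/-- As Re s < 0 on the ray, |exp(-(ξ - s) x)| ≤ exp(-ξ x), so Fubini applies and the x-integral is
1/(ξ - s). -/
theorem IsDecayAngle.integral_exp_mul_stableDensity (h : IsDecayAngle α θ) (hα0 : 0 < α)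
    {t : ℝ} (ht : 0 < t) {ξ : ℝ} (hξ : 0 < ξ) :
    ∫ x in Ioi (0 : ℝ), Real.exp (-ξ * x) * stableDensity α θ x t = Real.exp (-t * ξ ^ α) := by
  have hmeas : AEStronglyMeasurable (Function.uncurry fun x r : ℝ =>
      spaceWeight α θ t r * Complex.exp (-(ξ - rayPoint θ r) * x))
      ((volume.restrict (Ioi 0)).prod (volume.restrict (Ioi 0))) := by
    have h1 := (continuous_rayPoint θ)
    exact (aestronglyMeasurable_spaceWeight α θ t).comp_snd.mul
      (Continuous.aestronglyMeasurable (by fun_prop))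
  have hprod : Integrable (Function.uncurry fun x r : ℝ =>
      spaceWeight α θ t r * Complex.exp (-(ξ - rayPoint θ r) * x))
      ((volume.restrict (Ioi 0)).prod (volume.restrict (Ioi 0))) := by
    have h1 := (integrableOn_exp_mul_Ioi (a := -ξ) (by linarith) 0).mul_prod
      (h.integrable_spaceWeight hα0 ht).norm
    refine h1.mono' hmeas ?_
    rw [Measure.prod_restrict]
    filter_upwards [ae_restrict_mem (measurableSet_Ioi.prod measurableSet_Ioi)] with q hq
    have hq1 : 0 < q.1 := hq.1
    have hq2 : 0 < q.2 := hq.2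
    simp only [Function.uncurry]
    rw [norm_mul, mul_comm]
    refine mul_le_mul_of_nonneg_right ?_ (norm_nonneg _)
    rw [Complex.norm_exp, Real.exp_le_exp, Complex.re_mul_ofReal, Complex.neg_re, Complex.sub_re,
      Complex.ofReal_re, re_rayPoint]
    nlinarith [mul_pos (mul_pos hq1 hq2) h.neg_cos_pos]
  have hswap := integral_integral_swap hprod
  have hright : ∫ r in Ioi (0 : ℝ), (∫ x in Ioi (0 : ℝ),
      spaceWeight α θ t r * Complex.exp (-(ξ - rayPoint θ r) * x)) =
      ∫ r in Ioi (0 : ℝ), spaceWeight α θ t r * (1 / (ξ - rayPoint θ r)) := by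
    refine setIntegral_congr_fun measurableSet_Ioi fun r hr => ?_
    have hr : 0 < r := hr
    have hre : (-(ξ - rayPoint θ r)).re < 0 := by
      rw [Complex.neg_re, Complex.sub_re, Complex.ofReal_re, re_rayPoint]
      nlinarith [mul_pos hr h.neg_cos_pos]
    rw [integral_const_mul, integral_exp_mul_complex_Ioi hre, Complex.ofReal_zero, mul_zero,
      Complex.exp_zero, neg_div_neg_eq]
  have hleft : Integrable (fun x : ℝ => ∫ r in Ioi (0 : ℝ),
      spaceWeight α θ t r * Complex.exp (-(ξ - rayPoint θ r) * x)) (volume.restrict (Ioi 0)) :=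
    hprod.integral_prod_left
  rw [hright] at hswap
  rw [← h.re_integral_spaceWeight_div hα0 ht hξ, ← hswap]
  have h4 := integral_re hleft
  simp only [RCLike.re_to_complex] at h4
  rw [← h4]
  refine integral_congr_ae (Eventually.of_forall fun x => ?_)
  simp only
  rw [stableDensity_eq_space, ← Complex.re_ofReal_mul, ← integral_const_mul]
  congr 2
  funext r
  rw [show -((ξ : ℂ) - rayPoint θ r) * x = ((-ξ * x : ℝ) : ℂ) + -x * -rayPoint θ r by
    push_cast; ring, Complex.exp_add, Complex.ofReal_exp]
  ring

end StableLaplaceTransform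

/-! ### Identification of the density and its limit at time zero. -/

section StableLaw

variable {Ω : Type*} [MeasurableSpace Ω] {μ : Measure Ω} {α θ : ℝ} {A : ℝ≥0 → Ω → ℝ≥0}

theorem measurable_stableDensity (α θ t : ℝ) : Measurable fun x => stableDensity α θ x t := by
  simp only [stableDensity_eq_space]
  refine Complex.measurable_re.comp ?_
  have h1 := (continuous_rayPoint θ).measurable
  have h2 := measurable_rayPoint_cpow θ α
  have h3 : Measurable (spaceWeight α θ t) := by unfold spaceWeight; fun_prop
  have : Measurable (Function.uncurry fun (x r : ℝ) =>
      spaceWeight α θ t r * Complex.exp (-x * -rayPoint θ r)) := by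
    simp only [Function.uncurry_def]
    fun_prop
  exact (this.stronglyMeasurable.integral_prod_right).measurable

/-- A measure on the positive half line and a continuous function with the same Laplace transform:
the function is a density of the measure, and is nonnegative. -/
theorem eq_withDensity_of_laplace_eq {ν : Measure ℝ} {f : ℝ → ℝ} (hf : Measurable f)
    (hfc : ContinuousOn f (Ioi 0))
    (hν : ∀ ξ : ℝ, 0 < ξ → Integrable (fun x => Real.exp (-ξ * x)) ν)
    (hfi : ∀ ξ : ℝ, 0 < ξ → IntegrableOn (fun x => Real.exp (-ξ * x) * f x) (Ioi 0))
    (h : ∀ ξ : ℝ, 0 < ξ → ∫ x, Real.exp (-ξ * x) ∂ν = ∫ x in Ioi 0, Real.exp (-ξ * x) * f x) :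
    (∀ x, 0 < x → 0 ≤ f x) ∧
      ν = (volume.restrict (Ioi 0)).withDensity fun x => ENNReal.ofReal (f x) := by
  set κ : Measure ℝ := volume.restrict (Ioi 0) with hκ
  have hp : Measurable fun x => ENNReal.ofReal (f x) := hf.ennreal_ofReal
  have hn : Measurable fun x => ENNReal.ofReal (-f x) := hf.neg.ennreal_ofReal
  have hexp : ∀ ξ : ℝ, Measurable fun x : ℝ => Real.exp (-ξ * x) := fun ξ => by fun_prop
  have hpi : ∀ ξ : ℝ, 0 < ξ →
      Integrable (fun x => Real.exp (-ξ * x) * (ENNReal.ofReal (f x)).toReal) κ := by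
    intro ξ hξ
    refine Integrable.mono (hfi ξ hξ) ((hexp ξ).mul hp.ennreal_toReal).aestronglyMeasurable
      (Eventually.of_forall fun x => ?_)
    rw [norm_mul, norm_mul, ENNReal.toReal_ofReal', Real.norm_eq_abs (max _ _), Real.norm_eq_abs
      (f x), abs_of_nonneg (le_max_right _ _)]
    exact mul_le_mul_of_nonneg_left (max_le (le_abs_self _) (abs_nonneg _)) (norm_nonneg _)
  have hni : ∀ ξ : ℝ, 0 < ξ →
      Integrable (fun x => Real.exp (-ξ * x) * (ENNReal.ofReal (-f x)).toReal) κ := by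
    intro ξ hξ
    refine Integrable.mono (hfi ξ hξ) ((hexp ξ).mul hn.ennreal_toReal).aestronglyMeasurable
      (Eventually.of_forall fun x => ?_)
    rw [norm_mul, norm_mul, ENNReal.toReal_ofReal', Real.norm_eq_abs (max _ _), Real.norm_eq_abs
      (f x), abs_of_nonneg (le_max_right _ _)]
    exact mul_le_mul_of_nonneg_left (max_le (neg_le_abs _) (abs_nonneg _)) (norm_nonneg _)
  have hni' : ∀ ξ : ℝ, 0 < ξ → Integrable (fun x => Real.exp (-ξ * x))
      (κ.withDensity fun x => ENNReal.ofReal (-f x)) :=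
    fun ξ hξ => (integrable_withDensity_iff hn (by simp)).2 (hni ξ hξ)
  -- Since f is not yet known to be nonnegative, its negative part is added to ν and uniqueness is
  -- applied to two positive measures.
  have hmain : ν + κ.withDensity (fun x => ENNReal.ofReal (-f x)) =
      κ.withDensity fun x => ENNReal.ofReal (f x) := by
    refine Measure.ext_of_laplace (fun ξ hξ => (hν ξ hξ).add_measure (hni' ξ hξ))
      (fun ξ hξ => (integrable_withDensity_iff hp (by simp)).2 (hpi ξ hξ)) fun ξ hξ => ?_
    rw [integral_add_measure (hν ξ hξ) (hni' ξ hξ), h ξ hξ,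
      integral_withDensity_eq_integral_toReal_smul hn (by simp),
      integral_withDensity_eq_integral_toReal_smul hp (by simp), ← eq_sub_iff_add_eq]
    simp only [smul_eq_mul, mul_comm (ENNReal.toReal _)]
    rw [← integral_sub (hpi ξ hξ) (hni ξ hξ)]
    refine integral_congr_ae (Eventually.of_forall fun x => ?_)
    simp only
    rw [← mul_sub, ENNReal.toReal_ofReal', ENNReal.toReal_ofReal', max_zero_sub_eq_self]
  have hopen : IsOpen (Ioi 0 ∩ f ⁻¹' Iio 0) := hfc.isOpen_inter_preimage isOpen_Ioi isOpen_Iio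
  -- The measure with density f⁺ gives no mass to {f < 0}, so neither does the one with density f⁻;
  -- hence {f < 0} is null. By continuity it is open in the half line, thus empty.
  have hzero : κ (f ⁻¹' Iio 0) = 0 := by
    have h1 : (κ.withDensity fun x => ENNReal.ofReal (f x)) (f ⁻¹' Iio 0) = 0 := by
      rw [withDensity_apply_eq_zero hp]
      convert measure_empty (μ := κ)
      ext x
      simp only [mem_inter_iff, mem_ofPred_eq, ne_eq, ENNReal.ofReal_eq_zero, not_le, mem_preimage,
        mem_Iio, mem_empty_iff_false, iff_false, not_and, not_lt]
      exact fun h => h.le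
    rw [← hmain, Measure.add_apply, add_eq_zero] at h1
    have h2 := (withDensity_apply_eq_zero hn).1 h1.2
    convert h2 using 2
    ext x
    simp
  have hnonneg : ∀ x, 0 < x → 0 ≤ f x := by
    intro x hx
    by_contra hlt
    rw [hκ, Measure.restrict_apply (hf measurableSet_Iio), inter_comm,
      hopen.measure_eq_zero_iff (μ := volume)] at hzero
    exact (hzero ▸ (⟨hx, not_le.1 hlt⟩ : x ∈ Ioi 0 ∩ f ⁻¹' Iio 0) : x ∈ (∅ : Set ℝ))
  refine ⟨hnonneg, ?_⟩
  have hn0 : κ.withDensity (fun x => ENNReal.ofReal (-f x)) = 0 := by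
    rw [withDensity_eq_zero_iff hn.aemeasurable]
    filter_upwards [ae_restrict_mem measurableSet_Ioi] with x hx
    simpa using hnonneg x hx
  rw [← hmain, hn0, add_zero]

theorem IsDecayAngle.continuousOn_stableDensity (h : IsDecayAngle α θ) (hα0 : 0 < α)
    (hα1 : α < 1) (t : ℝ) : ContinuousOn (fun x => stableDensity α θ x t) (Ioi 0) :=
  fun _ hx => (h.hasDerivAt_space hα0 hα1 hx t).continuousAt.continuousWithinAt

theorem IsDecayAngle.isContinuousDensity [IsProbabilityMeasure μ] (h : IsDecayAngle α θ)
    (hα0 : 0 < α) (hα1 : α < 1) (hA : IsStableSubordinator α A μ) :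
    IsContinuousDensity μ A (stableDensity α θ) := by
  have key : ∀ t : ℝ, 0 < t → (∀ x, 0 < x → 0 ≤ stableDensity α θ x t) ∧
      μ.map (fun ω => (A t.toNNReal ω : ℝ)) = (volume.restrict (Ioi 0)).withDensity
        fun x => ENNReal.ofReal (stableDensity α θ x t) := by
    intro t ht
    have hm : Measurable fun ω => (A t.toNNReal ω : ℝ) := (hA.measurable _).coe_nnreal_real
    have hexp : ∀ ξ : ℝ, Measurable fun x : ℝ => Real.exp (-ξ * x) := fun ξ => by fun_prop
    obtain ⟨C, hC⟩ := h.abs_stableDensity_le hα0 ht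
    refine eq_withDensity_of_laplace_eq (measurable_stableDensity α θ t)
      (h.continuousOn_stableDensity hα0 hα1 t) (fun ξ hξ => ?_) (fun ξ hξ => ?_) fun ξ hξ => ?_
    · exact (integrable_map_measure (hexp ξ).aestronglyMeasurable hm.aemeasurable).2
        (hA.integrable_exp t.toNNReal hξ)
    · refine ((integrableOn_exp_mul_Ioi (neg_lt_zero.2 hξ) 0).mul_const C).mono'
        ((hexp ξ).mul (measurable_stableDensity α θ t)).aestronglyMeasurable ?_
      filter_upwards [ae_restrict_mem measurableSet_Ioi] with x hx
      rw [norm_mul, Real.norm_of_nonneg (Real.exp_nonneg _)]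
      exact mul_le_mul_of_nonneg_left (hC x hx) (Real.exp_nonneg _)
    · rw [h.integral_exp_mul_stableDensity hα0 ht hξ,
        integral_map hm.aemeasurable (hexp ξ).aestronglyMeasurable, hA.laplace _ ξ hξ.le,
        Real.coe_toNNReal t ht.le]
  exact ⟨fun x t hx ht => (key t ht).1 x hx,
    fun t _ => h.continuousOn_stableDensity hα0 hα1 t, fun t ht => (key t ht).2⟩

/-- Paths are right-continuous at 0 and start there; bounded convergence does the rest. -/
theorem IsSubordinator.tendsto_integral_zero [IsProbabilityMeasure μ]
    (hA : IsSubordinator (fun t ω => (A t ω : ℝ)) μ) {f : ℝ → ℝ} (hf : Continuous f)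
    {C : ℝ} (hC : ∀ x, |f x| ≤ C) :
    Tendsto (fun t : ℝ => ∫ ω, f (A t.toNNReal ω) ∂μ) (𝓝[>] 0) (𝓝 (f 0)) := by
  have h1 : Tendsto (fun t : ℝ => ∫ ω, f (A t.toNNReal ω) ∂μ) (𝓝[>] 0) (𝓝 (∫ _, f 0 ∂μ)) := by
    refine tendsto_integral_filter_of_dominated_convergence (fun _ => C)
      (Eventually.of_forall fun t => (hf.measurable.comp (hA.measurable _)).aestronglyMeasurable)
      (Eventually.of_forall fun t => Eventually.of_forall fun ω => hC _) (integrable_const _) ?_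
    filter_upwards [hA.zero, hA.paths] with ω h0 hω
    have h2 : Tendsto (fun t : ℝ => t.toNNReal) (𝓝[>] 0) (𝓝[≥] 0) := by
      refine tendsto_nhdsWithin_iff.2 ⟨?_, Eventually.of_forall fun t => mem_Ici.2 zero_le⟩
      exact (continuous_real_toNNReal.tendsto' 0 0 (by simp)).mono_left nhdsWithin_le_nhds
    have h3 := (hω.2 0).tendsto.comp h2
    have h0' : ((A 0 ω : ℝ≥0) : ℝ) = 0 := h0
    simp only [h0'] at h3
    exact (hf.tendsto 0).comp h3
  simpa using h1

theorem IsContinuousDensity.tendsto_integral [IsProbabilityMeasure μ] {h : ℝ → ℝ → ℝ}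
    (hh : IsContinuousDensity μ A h) (hA : IsSubordinator (fun t ω => (A t ω : ℝ)) μ)
    (hm : ∀ t, Measurable fun x => h x t) {f : ℝ → ℝ} (hf : Continuous f)
    {C : ℝ} (hC : ∀ x, |f x| ≤ C) :
    Tendsto (fun t => ∫ x in Ioi 0, f x * h x t) (𝓝[>] 0) (𝓝 (f 0)) := by
  refine (hA.tendsto_integral_zero hf hC).congr' ?_
  filter_upwards [self_mem_nhdsWithin] with t ht
  have ht : 0 < t := ht
  have h1 := integral_map (μ := μ) (hA.measurable t.toNNReal).aemeasurable
    hf.aestronglyMeasurable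
  rw [← h1, hh.law t ht, integral_withDensity_eq_integral_toReal_smul (hm t).ennreal_ofReal
    (by simp)]
  refine setIntegral_congr_fun measurableSet_Ioi fun x hx => ?_
  rw [ENNReal.toReal_ofReal (hh.nonneg x t hx ht), smul_eq_mul, mul_comm]

end StableLaw

/-! ### Derivatives at the end point 0 and the main theorem. -/

/-- Because j ≥ 1, the truncated subtraction is harmless and (j + 1)α ≤ 1. -/
theorem mul_lt_one_of_le_floor_sub_one {α : ℝ} (hα0 : 0 < α) {j : ℕ} (hj : 1 ≤ j)
    (hj' : j ≤ ⌊1 / α⌋₊ - 1) : α * j < 1 := by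
  have h1 : j + 1 ≤ ⌊1 / α⌋₊ := by omega
  have h2 : ((j + 1 : ℕ) : ℝ) ≤ 1 / α :=
    (Nat.cast_le.2 h1).trans (Nat.floor_le (by positivity))
  rw [le_div_iff₀ hα0] at h2
  push_cast at h2
  nlinarith

theorem iteratedDerivWithin_Ici_zero_eq {f : ℝ → ℝ} {g : ℝ → ℝ}
    (hf : ContDiffOn ℝ (⊤ : ℕ∞) f (Ioi (-1))) (hfg : EqOn g f (Ici 0)) (j : ℕ) :
    iteratedDerivWithin j g (Ici 0) 0 = iteratedDeriv j f 0 := by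
  rw [iteratedDerivWithin_congr hfg self_mem_Ici]
  exact iteratedDerivWithin_eq_iteratedDeriv (uniqueDiffOn_Ici 0)
    ((hf.contDiffAt (Ioi_mem_nhds (by norm_num))).of_le (by exact_mod_cast le_top)) self_mem_Ici

theorem contDiffOn_Ici_zero {f : ℝ → ℝ} {g : ℝ → ℝ}
    (hf : ContDiffOn ℝ (⊤ : ℕ∞) f (Ioi (-1))) (hfg : EqOn g f (Ici 0)) :
    ContDiffOn ℝ (⊤ : ℕ∞) g (Ici 0) :=
  (hf.mono (Ici_subset_Ioi.2 (by norm_num))).congr hfg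

theorem theorem4 {Ω : Type*} [MeasurableSpace Ω] (μ : Measure Ω) [IsProbabilityMeasure μ]
    (α : ℝ) (hα0 : 0 < α) (hα1 : α ≤ 1) (rate : ℝ≥0) (hrate : 0 < rate)
    (N : ℝ≥0 → Ω → ℕ) (A : ℝ≥0 → Ω → ℝ≥0)
    (hN : IsPoissonProcess rate N μ) (hA : IsStableSubordinator α A μ)
    (hNA : IndepFun (fun ω t => N t ω) (fun ω t => A t ω) μ)
    (p : ℤ → ℝ → ℝ) (hp : p = countingLaw μ (fun t ω => N (A t ω) ω)) :
    -- the equation of order `1 / α` for the law of `N(A_t)`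
    (∀ (k : ℕ) (t : ℝ), 0 < t →
      HasRLDeriv (1 / α) (p k) t
        (rate * (p k t - backwardShift (fun j => p j t) k))) ∧
    -- its initial conditions
    (∀ k : ℕ, p k 0 = if k = 0 then 1 else 0) ∧
    (∀ k : ℕ, ContDiffOn ℝ (⊤ : ℕ∞) (p k) (Ici 0)) ∧
    (∀ k j : ℕ, 1 ≤ j → j ≤ ⌊1 / α⌋₊ - 1 →
      iteratedDerivWithin j (p k) (Ici 0) 0 =
        (-1) ^ (k + j) * ((rate : ℝ) ^ (α * j) / (Nat.factorial k : ℝ)) *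
          (Real.Gamma (α * j + 1) / Real.Gamma (α * j + 1 - k))) ∧
    -- the density of the stable subordinator
    (α < 1 → ∃ h : ℝ → ℝ → ℝ, IsContinuousDensity μ A h ∧
      -- the equation of order `1 / α` for the density
      (∀ x t : ℝ, 0 < x → 0 < t →
        DifferentiableAt ℝ (fun y => h y t) x ∧
        HasRLDeriv (1 / α) (fun s => h x s) t (deriv (fun y => h y t) x)) ∧
      -- its initial and boundary conditions
      (∀ f : ℝ → ℝ, Continuous f → (∃ C, ∀ x, |f x| ≤ C) →
        Tendsto (fun t => ∫ x in Ioi 0, f x * h x t) (𝓝[>] 0) (𝓝 (f 0))) ∧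
      (∀ t : ℝ, 0 < t → Tendsto (fun x => h x t) (𝓝[>] 0) (𝓝 0)) ∧
      (∀ x : ℝ, 0 < x → ContDiffOn ℝ (⊤ : ℕ∞) (fun s => h x s) (Ici 0)) ∧
      (∀ (x : ℝ) (j : ℕ), 0 < x → 1 ≤ j → j ≤ ⌊1 / α⌋₊ - 1 →
        iteratedDerivWithin j (fun s => h x s) (Ici 0) 0 =
          (-1) ^ j * (x ^ (-α * j - 1) / Real.Gamma (-α * j)))) := by
  have hrate' : (0 : ℝ) < rate := by exact_mod_cast hrate
  have hpk : ∀ (k : ℕ) (t : ℝ), 0 ≤ t → p k t =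
      (∫ θ in Ioc 0 (2 * Real.pi), circleWeight rate k θ *
        Complex.exp (-t * circleMap (rate : ℝ) (rate / 2) θ ^ (α : ℂ))).re :=
    fun k t ht => hp ▸ countingLaw_comp_eq_integral_circle hrate hN hA hNA k ht
  have hsmooth := contDiffOn_integral_circle hrate' hα0 hα1
  refine ⟨fun k t ht => ?_, fun k => hp ▸ countingLaw_comp_zero hN hA hNA k,
    fun k => contDiffOn_Ici_zero (hsmooth k) fun t ht => hpk k t ht, fun k j hj hj' => ?_,
    fun hα => ?_⟩
  · convert hasRLDeriv_integral_circle hrate' hα0 hα1 k (fun s hs => hpk k s hs.le) ht using 3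
    · exact hpk k t ht.le
    · rcases k with _ | k
      -- For k = 0 the shifted term is p_{-1}, the probability of an empty event.
      · simp only [backwardShift, hp, countingLaw, if_pos]
        convert measureReal_empty
        ext ω
        simp
      · rw [if_neg k.succ_ne_zero, Nat.add_sub_cancel, ← hpk k t ht.le, backwardShift]
        congr 1
        push_cast
        ring
  · rw [iteratedDerivWithin_Ici_zero_eq (hsmooth k) (fun t ht => hpk k t ht)]
    exact iteratedDeriv_integral_circle_zero hrate' hα0 hα1 k j hj
      (mul_lt_one_of_le_floor_sub_one hα0 hj hj')
  · obtain ⟨θ, hθ⟩ := exists_isDecayAngle hα0 hα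
    have hdens := hθ.isContinuousDensity hα0 hα hA
    refine ⟨stableDensity α θ, hdens, fun x t hx ht => ?_, fun f hf ⟨C, hC⟩ => ?_,
      fun t ht => hθ.tendsto_space_zero hα0 ht, fun x hx => ?_, fun x j hx hj hj' => ?_⟩
    · have h1 := hθ.hasDerivAt_space hα0 hα hx t
      refine ⟨h1.differentiableAt, ?_⟩
      rw [h1.deriv]
      exact hθ.hasRLDeriv hα0 hα hx ht
    · exact hdens.tendsto_integral hA.subordinator (measurable_stableDensity α θ) hf hC
    · exact contDiffOn_Ici_zero (hθ.contDiff_time hα0 hα hx) fun _ _ => rfl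
    · rw [iteratedDerivWithin_Ici_zero_eq (hθ.contDiff_time hα0 hα hx) fun _ _ => rfl]
      exact hθ.iteratedDeriv_zero hα0 hα hx hj (mul_lt_one_of_le_floor_sub_one hα0 hj hj')
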